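/- Let $K$ be an algebraically closed field of any characteristic, let $n\ge 2$ and $\ell\ge 0$ be integers, and let $\underline x=(x_1,\dots,x_n)$ and $\underline\lambda=(\lambda_1,\dots,\lambda_\ell)$ be tuples of independent variables. Let $P,Q_1,\dots,Q_\ell\in K[\underline x]$ be non-zero polynomials, pairwise distinct up to multiplicative constants, not all constant and, if $\ell\ge 1$, relatively prime (no non-constant polynomial divides all of them). Put $$F(\underline x,\underline\lambda)=P(\underline x)+\lambda_1Q_1(\underline x)+\cdots+\lambda_\ell Q_\ell(\underline x).$$ Let $\phi,\psi\in K[\underline x]$ be relatively prime polynomials with $\deg_{\underline x}(F)>\max(\deg\phi,\deg\psi)$. A *$(\phi,\psi)$-homogeneous decomposition of $F$ of degree $d$* is an identity $F(\underline x,\underline\lambda)=H(\phi(\underline x),\psi(\underline x),\underline\lambda)$, where $H(u,v,\underline\lambda)\in\overline{K(\underline\lambda)}[u,v]$ is homogeneous of degree $d$ in $(u,v)$; if one exists, $F$ is said to be *$(\phi,\psi)$-homogeneously composed in degree $d$*. Such a decomposition is *maximal* if $\phi+\lambda\psi$ is irreducible in $\overline{K(\lambda)}[\underline x]$, where $\lambda$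 is a new single variable. **Proposition.** Assume that $F$ is $(\phi_0,\psi_0)$-homogeneously composed in degree $d_0$, where $\phi_0,\psi_0\in K[\underline x]$ are relatively prime and $\deg_{\underline x}(F)>\max(\deg\phi_0,\deg\psi_0)$. Then there exist $d\ge d_0$ and relatively prime $\phi,\psi\in K[\underline x]$ with $\deg_{\underline x}(F)>\max(\deg\phi,\deg\psi)$ such that $F$ has a maximal $(\phi,\psi)$-homogeneous decomposition of degree $d$. Moreover, if the initial $(\phi_0,\psi_0)$-homogeneous decomposition is not maximal, then such a decomposition exists with $d>d_0$. -/

import Mathlib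

open MvPolynomial

noncomputable section

namespace HomDecomp

/-- The algebraic closure of `K(λ₁, …, λ_ℓ)`. -/
abbrev ParamClosure (K : Type*) [Field K] (ℓ : ℕ) : Type _ :=
  AlgebraicClosure (FractionRing (MvPolynomial (Fin ℓ) K))

/-- The conditions on the data: the `ℓ + 1` polynomials `P, Q₁, …, Q_ℓ` of `K[x₁, …, x_n]` are
nonzero, pairwise distinct up to multiplicative constants, not all constant, and, if `ℓ ≥ 1`,
relatively prime (as a family). -/
structure Admissible {K : Type*} [Field K] {n ℓ : ℕ} (P : MvPolynomial (Fin n) K)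
    (Q : Fin ℓ → MvPolynomial (Fin n) K) : Prop where
  left_ne_zero : P ≠ 0
  right_ne_zero : ∀ i, Q i ≠ 0
  left_right_distinct : ∀ i, ∀ c : K, c ≠ 0 → P ≠ C c * Q i
  right_distinct : ∀ i j, i ≠ j → ∀ c : K, c ≠ 0 → Q i ≠ C c * Q j
  nonconstant : 0 < P.totalDegree ∨ ∃ i, 0 < (Q i).totalDegree
  relPrime : 1 ≤ ℓ → ∀ g : MvPolynomial (Fin n) K, g ∣ P → (∀ i, g ∣ Q i) → IsUnit g

/-- `F(x, λ) = P(x) + λ₁ Q₁(x) + ⋯ + λ_ℓ Q_ℓ(x)`, as a polynomial in `x` over `K[λ₁, …, λ_ℓ]`.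
In particular `(family P Q).totalDegree` is the degree in `x`. -/
def family {K : Type*} [Field K] {n ℓ : ℕ} (P : MvPolynomial (Fin n) K)
    (Q : Fin ℓ → MvPolynomial (Fin n) K) : MvPolynomial (Fin n) (MvPolynomial (Fin ℓ) K) :=
  map C P + ∑ i, C (X i) * map C (Q i)

/-- `F = H(φ, ψ)` is a `(φ, ψ)`-homogeneous decomposition of `F` of degree `d`: the polynomials
`φ, ψ ∈ K[x]` are relatively prime of degree less than the degree of `F` in `x`, and
`H(u, v)` is homogeneous of degree `d` in `(u, v)` over the algebraic closure of `K(λ)`. -/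
structure IsHomDecomposition {K : Type*} [Field K] {n ℓ : ℕ}
    (F : MvPolynomial (Fin n) (MvPolynomial (Fin ℓ) K)) (φ ψ : MvPolynomial (Fin n) K)
    (H : MvPolynomial (Fin 2) (ParamClosure K ℓ)) (d : ℕ) : Prop where
  relPrime : IsRelPrime φ ψ
  degree_lt : max φ.totalDegree ψ.totalDegree < F.totalDegree
  homogeneous : H.IsHomogeneous d
  eq : map (algebraMap (MvPolynomial (Fin ℓ) K) (ParamClosure K ℓ)) F =
    aeval ![map (algebraMap K (ParamClosure K ℓ)) φ, map (algebraMap K (ParamClosure K ℓ)) ψ] H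

/-- `F` is `(φ, ψ)`-homogeneously composed in degree `d`. -/
def IsHomComposed {K : Type*} [Field K] {n ℓ : ℕ}
    (F : MvPolynomial (Fin n) (MvPolynomial (Fin ℓ) K)) (φ ψ : MvPolynomial (Fin n) K)
    (d : ℕ) : Prop :=
  ∃ H : MvPolynomial (Fin 2) (ParamClosure K ℓ), IsHomDecomposition F φ ψ H d

/-- Maximality of a `(φ, ψ)`-homogeneous decomposition, which is a condition on `(φ, ψ)` only:
`φ + λ ψ` is irreducible over the algebraic closure of `K(λ)`, for a single new variable `λ`. -/
def IsMaximalPair {K : Type*} [Field K] {n : ℕ} (φ ψ : MvPolynomial (Fin n) K) : Prop :=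
  Irreducible (map (algebraMap K (AlgebraicClosure (RatFunc K))) φ +
    C (algebraMap (RatFunc K) (AlgebraicClosure (RatFunc K)) RatFunc.X) *
      map (algebraMap K (AlgebraicClosure (RatFunc K))) ψ)

end HomDecomp

end

/-! The engine is a Bertini–Krull–Lüroth statement, `exists_forms_of_not_isMaximalPair`: if `φ + λψ`
is not irreducible over the closure of `K(λ)`, then `φ` and `ψ` are forms of one degree `e` in
coprime `r`, `s` of smaller degree. Comparing degrees gives `e ≥ 2`. Substituting the forms into `H`
multiplies the degree `d` by `e` while the pair drops in degree, so iterating ends at a maximal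
pair.

For the engine, let `M = K(x)` and `f = φ/ψ`, embed `K(λ)` in `M` by `λ ↦ -f`, and let `E` be the
algebraic closure of `K(f)` in `M`. The relations of the generic point over `K(f)` are generated by
`φ(y) - f ψ(y)`. Over `E` they remain principal, and, as in Lüroth's theorem, some `r(y) - g s(y)`
with `g = r/s` in `E` generates them (`exists_fiberPoly_generator`). This generator divides `φ(y) -
f ψ(y)`, so its degree in `x`, after clearing denominators, is at most that of `f`.

If the degree drops, divisibility forces `f ∈ K(g)` (`mem_adjoin_of_fiberPoly_dvd`), and writing `f`
in lowest terms in `g` yields the forms. If not, `φ(y) - f ψ(y)` generates the relations over `E`;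
when some partial derivative is nonzero it is then irreducible over the closure of `E`
(`irreducible_map_of_aeval_eq_zero_iff_dvd`), contrary to assumption. When all partial derivatives
vanish, the characteristic is `p > 0` and `φ`, `ψ` are `p`-th powers. -/

/-! ### Relation ideals under algebraic extension, and absolute irreducibility -/

/-- If the relations of `x` over `k₀` form the principal ideal generated by `p ≠ 0`, then over any
algebraic extension `k` of `k₀` they form a principal ideal generated by an irreducible. -/
theorem exists_irreducible_aeval_eq_zero_iff_dvd {k₀ k N σ : Type*} [Field k₀] [Field k] [Field N]
    [Algebra k₀ k] [Algebra k N] [Algebra k₀ N] [IsScalarTower k₀ k N] [Algebra.IsAlgebraic k₀ k]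
    (x : σ → N) (p : MvPolynomial σ k₀) (hp : p ≠ 0) (h : ∀ q, aeval x q = 0 ↔ p ∣ q) :
    ∃ G : MvPolynomial σ k, Irreducible G ∧ ∀ q, aeval x q = 0 ↔ G ∣ q := by
  classical
  let e := algebraMap k₀ k
  have hmap : ∀ q : MvPolynomial σ k₀, aeval x (map e q) = aeval x q := fun q ↦ by
    rw [aeval_map_algebraMap]
  let J : Ideal (MvPolynomial σ k) := RingHom.ker (aeval x : MvPolynomial σ k →ₐ[k] N)
  have hJp : J.IsPrime := RingHom.ker_isPrime _
  have hmem : map e p ∈ J := by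
    change aeval x _ = 0
    rw [hmap, h]
  have hp' : map e p ≠ 0 := by
    rwa [Ne, map_eq_zero_iff _ (map_injective _ e.injective)]
  obtain ⟨G, hG, hGp, hGJ⟩ : ∃ G, Prime G ∧ G ∣ map e p ∧ G ∈ J := by
    obtain ⟨f, hf, u, hu⟩ := UniqueFactorizationMonoid.exists_prime_factors (map e p) hp'
    have : f.prod ∈ J := by
      rw [← hu] at hmem
      exact (hJp.mem_or_mem hmem).resolve_right fun hh ↦
        hJp.ne_top (Ideal.eq_top_of_isUnit_mem _ hh u.isUnit)
    obtain ⟨G, hGf, hGJ⟩ := (Ideal.IsPrime.multiset_prod_mem_iff_exists_mem hJp f).1 this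
    exact ⟨G, hf G hGf, (Multiset.dvd_prod hGf).trans ⟨u, hu.symm⟩, hGJ⟩
  refine ⟨G, hG.irreducible, ?_⟩
  let : Algebra (MvPolynomial σ k₀) (MvPolynomial σ k) := algebraMvPolynomial
  have hle : Ideal.span {G} ≤ J := by simpa [Ideal.span_le] using hGJ
  have hGpr : (Ideal.span {G}).IsPrime := (Ideal.span_singleton_prime hG.ne_zero).2 hG
  have heq : Ideal.span {G} = J := by
    by_contra hne
    -- Incomparability: distinct nested primes of the integral extension have distinct contractions,
    -- yet `J` contracts to `(p)`, which already lies in the contraction of `(G)`.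
    have hlt := Ideal.IsIntegral.comap_lt_comap (R := MvPolynomial σ k₀) (lt_of_le_of_ne hle hne)
    obtain ⟨-, q, hqJ, hqG⟩ := SetLike.lt_iff_le_and_exists.mp hlt
    have h1 : aeval x (map e q) = 0 := hqJ
    rw [hmap, h] at h1
    exact hqG (Ideal.mem_span_singleton.2 (hGp.trans (_root_.map_dvd (map e) h1)))
  intro q
  rw [← Ideal.mem_span_singleton, heq]
  rfl

theorem totalDegree_pderiv_lt {R σ : Type*} [CommSemiring R] {p : MvPolynomial σ R} {i : σ}
    (h : pderiv i p ≠ 0) : (pderiv i p).totalDegree < p.totalDegree := by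
  classical
  obtain ⟨m, hm, hd⟩ := (pderiv i p).support.exists_mem_eq_sup
    (support_nonempty.2 h) (fun m ↦ m.sum fun _ e ↦ e)
  have hm' : m + Finsupp.single i 1 ∈ p.support := by
    rw [mem_support_iff] at hm ⊢
    intro h0
    rw [coeff_pderiv, h0, zero_mul] at hm
    exact hm rfl
  have := le_totalDegree hm'
  rw [Finsupp.sum_add_index' (fun _ ↦ rfl) (fun _ _ _ ↦ rfl), Finsupp.sum_single_index rfl] at this
  rw [totalDegree, hd]
  exact Nat.lt_of_succ_le this

/-- An element of a normal extension of `M` fixed by all automorphisms has a power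
(by the exponential characteristic) lying in `M`. -/
theorem exists_pow_mem_range_of_fixed {M N : Type*} [Field M] [Field N] [Algebra M N] [Normal M N]
    (q : ℕ) [ExpChar M q] (c : N) (h : ∀ s : N ≃ₐ[M] N, s c = c) :
    ∃ k : ℕ, c ^ q ^ k ∈ (algebraMap M N).range := by
  classical
  rw [← minpoly.natSepDegree_eq_one_iff_pow_mem, Polynomial.natSepDegree_eq_of_splits _ (Normal.splits ‹_› c)]
  have hc : IsIntegral M c := Normal.isIntegral ‹_› c
  have : (minpoly M c).rootSet N = {c} := by
    ext y
    rw [Polynomial.mem_rootSet, Set.mem_singleton_iff]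
    constructor
    · rintro ⟨-, hy⟩
      obtain ⟨s, hs⟩ := minpoly.exists_algEquiv_of_root' hc.isAlgebraic hy
      rw [← hs, h]
    · rintro rfl
      exact ⟨minpoly.ne_zero hc, minpoly.aeval _ _⟩
  rw [Finset.card_eq_one]
  exact ⟨c, Finset.coe_injective (by rw [← Polynomial.rootSet, this, Finset.coe_singleton])⟩

/-- Let `E` be algebraically closed in `M` and suppose that the relations of `x` over `E` form the
principal ideal generated by `p`. If `p` has a nonzero partial derivative then `p` is irreducible
over the algebraic closure of `E`. -/
theorem irreducible_map_of_aeval_eq_zero_iff_dvd {E M L σ : Type*} [Field E] [Field M] [Field L]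
    [Algebra E M] [Algebra E L] [Algebra.IsAlgebraic E L] [IsAlgClosed L]
    (hE : ∀ a : M, IsAlgebraic E a → a ∈ (algebraMap E M).range)
    (x : σ → M) (p : MvPolynomial σ E) (h : ∀ q, aeval x q = 0 ↔ p ∣ q)
    (i : σ) (hi : pderiv i p ≠ 0) :
    Irreducible (map (algebraMap E L) p) := by
  classical
  have hp : p ≠ 0 := by rintro rfl; simp at hi
  let N := AlgebraicClosure M
  let ι : L →ₐ[E] N := IsAlgClosed.lift
  let : Algebra L N := ι.toRingHom.toAlgebra
  have : IsScalarTower E L N := IsScalarTower.of_algebraMap_eq fun c ↦ (ι.commutes c).symm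
  let x' : σ → N := fun j ↦ algebraMap M N (x j)
  have hx' : ∀ q : MvPolynomial σ E, aeval x' q = algebraMap M N (aeval x q) := fun q ↦ by
    rw [← aeval_algebraMap_apply]; rfl
  have h' : ∀ q : MvPolynomial σ E, aeval x' q = 0 ↔ p ∣ q := fun q ↦ by
    rw [hx', map_eq_zero, h]
  have : IsAlgClosure E L := ⟨inferInstance, inferInstance⟩
  have : Normal E L := IsAlgClosure.normal E L
  obtain ⟨G₀, hG₀, hG₀'⟩ := exists_irreducible_aeval_eq_zero_iff_dvd (k := L) x' p hp h'
  obtain ⟨m, hm⟩ := ne_zero_iff.1 hG₀.ne_zero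
  -- One coefficient is normalized to 1, so that a conjugate of `G` associated to `G` must equal it.
  obtain ⟨G, hG, hGm, hGdvd⟩ : ∃ G : MvPolynomial σ L, Irreducible G ∧ coeff m G = 1 ∧
      ∀ q, aeval x' q = 0 ↔ G ∣ q := by
    have ha : Associated (C (coeff m G₀)⁻¹ * G₀) G₀ :=
      associated_unit_mul_left _ _ ((isUnit_iff_ne_zero.2 (inv_ne_zero hm)).map C)
    refine ⟨C (coeff m G₀)⁻¹ * G₀, ha.symm.irreducible hG₀, ?_, fun q ↦ ?_⟩
    · rw [coeff_C_mul, inv_mul_cancel₀ hm]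
    · rw [hG₀', ha.dvd_iff_dvd_left]
  have hinv : ∀ (s : N ≃ₐ[M] N) (a), s (algebraMap L N (coeff a G)) = algebraMap L N (coeff a G) := by
    intro s a
    let s' : L →ₐ[E] L := (AlgHom.restrictNormal (F := E) (s.restrictScalars E).toAlgHom L)
    have hs' : ∀ c, algebraMap L N (s' c) = s (algebraMap L N c) := fun c ↦
      AlgHom.restrictNormal_commutes _ L c
    have h1 : aeval x' (map (s' : L →+* L) G) = 0 := by
      have h2 : aeval x' (map (s' : L →+* L) G) = s (aeval x' G) := by
        rw [aeval_def, eval₂_map, aeval_def, ← RingHom.coe_coe s, hom_eval₂]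
        congr 1
        · ext c; exact hs' c
        · ext j; exact (s.commutes (x j)).symm
      rw [h2, (hGdvd G).2 dvd_rfl, map_zero]
    obtain ⟨c, hc⟩ := (hGdvd _).1 h1
    have hne : map (s' : L →+* L) G ≠ 0 := by
      rw [Ne, map_eq_zero_iff _ (map_injective _ (s' : L →+* L).injective)]
      exact hG.ne_zero
    have hc0 : c ≠ 0 := by rintro rfl; exact hne (by rw [hc, mul_zero])
    have hdeg := congrArg totalDegree hc
    rw [totalDegree_mul_of_isDomain hG.ne_zero hc0, totalDegree,
      support_map_of_injective _ (s' : L →+* L).injective, ← totalDegree] at hdeg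
    have hc1 := totalDegree_eq_zero_iff_eq_C.1 (show c.totalDegree = 0 by omega)
    rw [hc1, mul_comm] at hc
    have hm1 := congrArg (coeff m) hc
    rw [coeff_map, coeff_C_mul, hGm, map_one, mul_one] at hm1
    rw [← hm1, C_1, one_mul] at hc
    rw [← hs']
    congr 1
    have h3 := congrArg (coeff a) hc
    rwa [coeff_map] at h3
  obtain ⟨q, hq⟩ := ExpChar.exists M
  have : ExpChar E q := (algebraMap E M).expChar (algebraMap E M).injective q
  have : ExpChar L q := expChar_of_injective_algebraMap (algebraMap E L).injective q
  -- Being fixed by the automorphisms over `M`, each coefficient has a `q`-power in `M`; that power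
  -- is algebraic over `E`, hence in `E`.
  have hpow : ∀ a, ∃ k, coeff a G ^ q ^ k ∈ (algebraMap E L).range := by
    intro a
    obtain ⟨k, b, hb⟩ := exists_pow_mem_range_of_fixed (M := M) q _ (fun s ↦ hinv s a)
    obtain ⟨e, rfl⟩ := hE b (by
      have : IsAlgebraic E (algebraMap M N b) := by
        rw [hb, ← map_pow]
        exact (Algebra.IsAlgebraic.isAlgebraic (R := E) (coeff a G ^ q ^ k)).algebraMap
      exact (isAlgebraic_algebraMap_iff (algebraMap M N).injective).1 this)
    refine ⟨k, e, (algebraMap L N).injective ?_⟩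
    rw [map_pow, ← hb, ← IsScalarTower.algebraMap_apply, ← IsScalarTower.algebraMap_apply]
  choose k hk using hpow
  let κ := G.support.sup k
  have hrange : G ^ q ^ κ ∈ (map (algebraMap E L) : MvPolynomial σ E →+* _).range := by
    have : ExpChar (MvPolynomial σ L) q :=
      expChar_of_injective_ringHom (C_injective σ L) q
    rw [G.as_sum, ← iterateFrobenius_def, map_sum]
    refine Subring.sum_mem _ fun a ha ↦ ?_
    obtain ⟨e, he⟩ := hk a
    obtain ⟨t, ht⟩ := Nat.exists_eq_add_of_le (Finset.le_sup ha : k a ≤ κ)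
    refine ⟨monomial (q ^ κ • a) (e ^ q ^ t), ?_⟩
    rw [map_monomial, map_pow, he, iterateFrobenius_def, monomial_pow, ← pow_mul, ← pow_add, ← ht]
  obtain ⟨H, hH⟩ := hrange
  have hpH : p ∣ H := by
    rw [← h', ← aeval_map_algebraMap L, hH, map_pow, (hGdvd G).2 dvd_rfl, zero_pow]
    exact pow_ne_zero _ (expChar_pos L q).ne'
  have hpG : map (algebraMap E L) p ∣ G ^ q ^ κ := hH ▸ _root_.map_dvd _ hpH
  obtain ⟨B, hB⟩ : G ∣ map (algebraMap E L) p := by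
    rw [← hGdvd, aeval_map_algebraMap, h']
  -- If `G²` divided `p`, then `G` would divide the derivative of `p`. This has coefficients in `E`,
  -- so `p` itself would divide it, against degrees. As `p` also divides a power of `G`, the
  -- cofactor `B` is a unit.
  have hGB : ¬ G ∣ B := by
    rintro ⟨B', rfl⟩
    have h1 : G ∣ map (algebraMap E L) (pderiv i p) := by
      rw [← pderiv_map, hB, Derivation.leibniz, Derivation.leibniz]
      simp only [smul_eq_mul]
      exact ⟨G * pderiv i B' + 2 * B' * pderiv i G, by ring⟩
    rw [← hGdvd, aeval_map_algebraMap, h'] at h1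
    obtain ⟨c, hc⟩ := h1
    have hc0 : c ≠ 0 := by rintro rfl; exact hi (by rw [hc, mul_zero])
    have hlt := totalDegree_pderiv_lt hi
    rw [hc, totalDegree_mul_of_isDomain hp hc0] at hlt
    omega
  have hBu : IsUnit B := by
    have hrel : IsRelPrime B G := ((hG.isRelPrime_iff_not_dvd).2 hGB).symm
    exact hrel.pow_right.isUnit_of_dvd (Dvd.dvd.trans ⟨G, by rw [hB, mul_comm]⟩ hpG)
  rw [hB]
  exact (associated_mul_unit_right G B hBu).irreducible hG

/-! ### Gauss's lemma in several variables -/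

/-- Clearing the denominators of a polynomial over a fraction field. -/
theorem MvPolynomial.exists_C_mul_eq_map {A M σ : Type*} [CommRing A] [IsDomain A] [Field M]
    [Algebra A M] [IsFractionRing A M] (h : MvPolynomial σ M) :
    ∃ a : A, a ≠ 0 ∧ ∃ h' : MvPolynomial σ A,
      C (algebraMap A M a) * h = map (algebraMap A M) h' := by
  let : Algebra (MvPolynomial σ A) (MvPolynomial σ M) := algebraMvPolynomial
  obtain ⟨⟨h', ⟨_, a, ha, rfl⟩⟩, hh⟩ :=
    IsLocalization.surj (M := (nonZeroDivisors A).map (C (σ := σ))) h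
  refine ⟨a, nonZeroDivisors.ne_zero ha, h', ?_⟩
  rw [mul_comm, ← map_C]
  exact hh

theorem MvPolynomial.dvd_of_dvd_C_mul {A σ : Type*} [CommRing A] [IsDomain A]
    [UniqueFactorizationMonoid A] {G T : MvPolynomial σ A} (hG : ∀ π : A, Prime π → ¬ C π ∣ G)
    {a : A} (ha : a ≠ 0) (h : G ∣ C a * T) : G ∣ T := by
  induction a using UniqueFactorizationMonoid.induction_on_prime generalizing T with
  | h₁ => exact absurd rfl ha
  | h₂ u hu => exact (hu.map C).dvd_mul_left.1 h
  | h₃ a π ha' hπ ih =>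
    obtain ⟨Q, hQ⟩ := h
    have hCπ : Prime (C π : MvPolynomial σ A) := (prime_C_iff σ).2 hπ
    obtain ⟨Q', rfl⟩ : C π ∣ Q := by
      refine (hCπ.dvd_or_dvd (a := G) ?_).resolve_left (hG π hπ)
      rw [← hQ, C_mul, mul_assoc]
      exact dvd_mul_right _ _
    refine ih ha' ⟨Q', mul_left_cancel₀ hCπ.ne_zero ?_⟩
    rw [← mul_assoc, ← C_mul, hQ]
    ring

/-- Gauss's lemma: divisibility by a primitive polynomial can be checked over the fraction
field. -/
theorem MvPolynomial.dvd_of_map_dvd_map {A M σ : Type*} [CommRing A] [IsDomain A]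
    [UniqueFactorizationMonoid A] [Field M] [Algebra A M] [IsFractionRing A M]
    {G T : MvPolynomial σ A} (hG : ∀ π : A, Prime π → ¬ C π ∣ G)
    (h : map (algebraMap A M) G ∣ map (algebraMap A M) T) : G ∣ T := by
  obtain ⟨Q, hQ⟩ := h
  obtain ⟨a, ha, Q', hQ'⟩ := exists_C_mul_eq_map (A := A) Q
  refine dvd_of_dvd_C_mul hG ha ⟨Q', map_injective _ (IsFractionRing.injective A M) ?_⟩
  rw [map_mul, map_mul, map_C, hQ, ← hQ']
  ring

theorem MvPolynomial.exists_eq_C_mul_primitive {A σ : Type*} [CommRing A] [IsDomain A]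
    [UniqueFactorizationMonoid A] {G : MvPolynomial σ A} (hG : G ≠ 0) :
    ∃ (b : A) (G' : MvPolynomial σ A), G = C b * G' ∧ ∀ π : A, Prime π → ¬ C π ∣ G' := by
  -- Choosing `G'` minimal for strict divisibility extracts the whole content without needing gcds
  -- of coefficients.
  obtain ⟨G', ⟨b, hb⟩, hmin⟩ := (wellFounded_dvdNotUnit (α := MvPolynomial σ A)).has_min
    {G' | ∃ b, G = C b * G'} ⟨G, 1, by simp⟩
  refine ⟨b, G', hb, fun π hπ ↦ ?_⟩
  rintro ⟨G'', rfl⟩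
  refine hmin G'' ⟨b * π, by rw [hb, C_mul, mul_assoc]⟩ ⟨?_, C π, ?_, mul_comm _ _⟩
  · rintro rfl; simp_all
  · exact ((prime_C_iff σ).2 hπ).not_isUnit

/-- If `a ∣ b` over `E` and `b ∣ a` over an extension then `b ∣ a` over `E`. -/
theorem MvPolynomial.dvd_of_dvd_of_map_dvd {E M σ : Type*} [Field E] [Field M] [Algebra E M]
    {a b : MvPolynomial σ E} (ha : a ≠ 0) (hab : a ∣ b)
    (h : map (algebraMap E M) b ∣ map (algebraMap E M) a) : b ∣ a := by
  obtain ⟨q, rfl⟩ := hab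
  have hq : q ≠ 0 := by
    rintro rfl
    rw [mul_zero, map_zero, zero_dvd_iff, map_eq_zero_iff _ (map_injective _ (algebraMap E M).injective)] at h
    exact ha h
  obtain ⟨c, hc⟩ := h
  have hc0 : c ≠ 0 := by
    rintro rfl
    rw [mul_zero, map_eq_zero_iff _ (map_injective _ (algebraMap E M).injective)] at hc
    exact ha hc
  have hM : ∀ d : MvPolynomial σ E, (map (algebraMap E M) d).totalDegree = d.totalDegree := by
    intro d
    rw [totalDegree, support_map_of_injective _ (algebraMap E M).injective, ← totalDegree]
  have hM0 : map (algebraMap E M) (a * q) ≠ 0 := by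
    rw [Ne, map_eq_zero_iff _ (map_injective _ (algebraMap E M).injective)]
    exact mul_ne_zero ha hq
  have hd := congrArg totalDegree hc
  rw [totalDegree_mul_of_isDomain hM0 hc0, hM, hM, totalDegree_mul_of_isDomain ha hq] at hd
  have hq1 := totalDegree_eq_zero_iff_eq_C.1 (show q.totalDegree = 0 by omega)
  have hu : IsUnit q := by
    rw [hq1] at hq ⊢
    exact (isUnit_iff_ne_zero.2 (fun h0 ↦ hq (by rw [h0, C_0]))).map C
  exact hu.mul_right_dvd.2 dvd_rfl

/-! ### The polynomial `r(y)s(x) - r(x)s(y)` and its degree in `x` -/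

section Cross

variable {K σ : Type*} [Field K]

/-- Exchanging the two groups of variables of `K[x][y]`. -/
noncomputable abbrev swapVars : MvPolynomial σ (MvPolynomial σ K) ≃ₐ[K] MvPolynomial σ (MvPolynomial σ K) :=
  commAlgEquiv K σ σ

theorem coeff_coeff_swapVars (G : MvPolynomial σ (MvPolynomial σ K)) (m m' : σ →₀ ℕ) :
    coeff m (coeff m' (swapVars G)) = coeff m' (coeff m G) := by
  classical
  induction G using MvPolynomial.induction_on' with
  | add p q hp hq => simp only [map_add, coeff_add, hp, hq]
  | monomial n p =>
    induction p using MvPolynomial.induction_on' with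
    | add p q hp hq => simp only [map_add, coeff_add, hp, hq]
    | monomial n' a =>
      have h : swapVars (monomial n (monomial n' a)) = monomial n' (monomial n a) :=
        AddMonoidAlgebra.commAlgEquiv_single_single ..
      rw [h]
      simp only [coeff_monomial]
      split_ifs <;> simp_all [coeff_monomial]

theorem swapVars_map_C (k : MvPolynomial σ K) : swapVars (map C k) = C k := by
  classical
  ext m m'
  rw [coeff_coeff_swapVars, coeff_map, coeff_C, coeff_C]
  split_ifs <;> simp_all

theorem totalDegree_coeff_le_swapVars (G : MvPolynomial σ (MvPolynomial σ K)) (m : σ →₀ ℕ) :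
    (coeff m G).totalDegree ≤ (swapVars G).totalDegree := by
  refine Finset.sup_le fun m' hm' ↦ le_totalDegree ?_
  rw [mem_support_iff] at hm' ⊢
  intro h
  rw [← coeff_coeff_swapVars, h, coeff_zero] at hm'
  exact hm' rfl

/-- The polynomial `r(y) s(x) - r(x) s(y)`, in the variables `y` over `K[x]`. -/
noncomputable def crossDiff (r s : MvPolynomial σ K) : MvPolynomial σ (MvPolynomial σ K) :=
  C s * map C r - C r * map C s

variable {r s : MvPolynomial σ K}

/-- Antisymmetry lets every statement about `y` be transferred to `x`, in particular degrees and the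
absence of factors in one group of variables. -/
theorem swapVars_crossDiff (r s : MvPolynomial σ K) : swapVars (crossDiff r s) = -crossDiff r s := by
  simp only [crossDiff, map_sub, map_mul, swapVars_map_C, swapVars, commAlgEquiv_C]
  ring

theorem coeff_crossDiff (r s : MvPolynomial σ K) (m : σ →₀ ℕ) :
    coeff m (crossDiff r s) = C (coeff m r) * s - C (coeff m s) * r := by
  simp only [crossDiff, coeff_sub, coeff_C_mul, coeff_map]
  ring

theorem exists_det_ne_zero (hs : s ≠ 0) (hrs : ∀ c, r ≠ C c * s) :
    ∃ m m', coeff m r * coeff m' s - coeff m' r * coeff m s ≠ 0 := by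
  by_contra! h
  obtain ⟨m, hm⟩ := ne_zero_iff.1 hs
  refine hrs (coeff m r / coeff m s) ?_
  ext m'
  rw [coeff_C_mul]
  field_simp
  linear_combination - h m m'

theorem coeff_crossDiff_ne_zero (hrs : ∀ c, r ≠ C c * s) (hs : s ≠ 0) {m : σ →₀ ℕ}
    (h : coeff m r ≠ 0 ∨ coeff m s ≠ 0) : coeff m (crossDiff r s) ≠ 0 := by
  rw [coeff_crossDiff, sub_ne_zero]
  intro h0
  by_cases hm : coeff m s = 0
  · rw [hm, C_0, zero_mul] at h0
    simp_all
  · refine hrs (coeff m r / coeff m s) ?_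
    rw [div_eq_inv_mul, C_mul, mul_assoc, h0, ← mul_assoc, ← C_mul, inv_mul_cancel₀ hm, C_1, one_mul]

theorem totalDegree_swapVars_crossDiff (hrs : ∀ c, r ≠ C c * s) (hs : s ≠ 0) :
    (swapVars (crossDiff r s)).totalDegree = max r.totalDegree s.totalDegree := by
  have hneg : (swapVars (crossDiff r s)).totalDegree = (crossDiff r s).totalDegree := by
    rw [swapVars_crossDiff, totalDegree_neg]
  rw [hneg]
  have hmap : ∀ r : MvPolynomial σ K,
      (map (C : K →+* MvPolynomial σ K) r).totalDegree ≤ r.totalDegree := fun r ↦ by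
    rw [totalDegree, support_map_of_injective _ (C_injective σ K), ← totalDegree]
  refine le_antisymm ?_ (max_le ?_ ?_)
  · refine (totalDegree_sub _ _).trans (max_le_max ?_ ?_) <;>
    · refine (totalDegree_mul _ _).trans ?_
      rw [totalDegree_C, zero_add]
      exact hmap _
  all_goals
    refine Finset.sup_le fun m hm ↦ le_totalDegree (mem_support_iff.2 ?_)
    refine coeff_crossDiff_ne_zero hrs hs ?_
    rw [mem_support_iff] at hm
    simp [hm]

/-- By Cramer's rule, two coefficients with nonzero determinant recover `r` and `s` up to a
constant, so a common divisor of the coefficients divides both. -/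
theorem isUnit_of_C_dvd_crossDiff (hrel : IsRelPrime r s) (hs : s ≠ 0) (hrs : ∀ c, r ≠ C c * s)
    {k : MvPolynomial σ K} (h : C k ∣ crossDiff r s) : IsUnit k := by
  obtain ⟨m, m', hd⟩ := exists_det_ne_zero hs hrs
  rw [C_dvd_iff_dvd_coeff] at h
  have h1 := h m
  have h2 := h m'
  rw [coeff_crossDiff] at h1 h2
  have hu := (isUnit_iff_ne_zero.2 hd).map (C : K →+* MvPolynomial σ K)
  refine hrel ?_ ?_
  · rw [← hu.dvd_mul_left]
    convert dvd_sub (h1.mul_left (C (coeff m' r))) (h2.mul_left (C (coeff m r))) using 1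
    simp only [C_mul, map_sub]
    ring
  · rw [← hu.dvd_mul_left]
    convert dvd_sub (h1.mul_left (C (coeff m' s))) (h2.mul_left (C (coeff m s))) using 1
    simp only [C_mul, map_sub]
    ring

/-- A divisor of `r(y) s(x) - r(x) s(y)` of full degree in `x` is associated to it. -/
theorem crossDiff_dvd_of_dvd (hrel : IsRelPrime r s) (hs : s ≠ 0) (hrs : ∀ c, r ≠ C c * s)
    {G : MvPolynomial σ (MvPolynomial σ K)} (hG : G ∣ crossDiff r s)
    (hdeg : max r.totalDegree s.totalDegree ≤ (swapVars G).totalDegree) : crossDiff r s ∣ G := by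
  obtain ⟨Q, hQ⟩ := hG
  have h0 : crossDiff r s ≠ 0 := by
    obtain ⟨m, hm⟩ := ne_zero_iff.1 hs
    exact ne_zero_iff.2 ⟨m, coeff_crossDiff_ne_zero hrs hs (.inr hm)⟩
  have hG0 : swapVars G ≠ 0 := by
    rw [EmbeddingLike.map_ne_zero_iff]
    rintro rfl
    exact h0 (by rw [hQ, zero_mul])
  have hQ0 : swapVars Q ≠ 0 := by
    rw [EmbeddingLike.map_ne_zero_iff]
    rintro rfl
    exact h0 (by rw [hQ, mul_zero])
  have hQ' := congrArg swapVars hQ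
  rw [map_mul] at hQ'
  have hd := congrArg totalDegree hQ'
  rw [totalDegree_mul_of_isDomain hG0 hQ0, totalDegree_swapVars_crossDiff hrs hs] at hd
  -- The degree in `x` is exhausted by `G`, so `Q` involves only `y`; by antisymmetry such a factor
  -- is a unit.
  have hk := totalDegree_eq_zero_iff_eq_C.1 (show (swapVars Q).totalDegree = 0 by omega)
  have hu : IsUnit (swapVars Q) := by
    rw [hk]
    refine (isUnit_of_C_dvd_crossDiff hrel hs hrs ?_).map C
    rw [← hk, ← dvd_neg, ← swapVars_crossDiff, hQ']
    exact dvd_mul_left _ _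
  have hu' : IsUnit Q := (MulEquiv.isUnit_map swapVars).1 hu
  rw [hQ]
  exact hu'.mul_right_dvd.2 dvd_rfl

end Cross

/-! ### Relations of the generic point over `K(φ/ψ)` -/

section Relations

variable {K σ M : Type*} [Field K] [Field M] [Algebra (MvPolynomial σ K) M] [Algebra K M]
  [IsScalarTower K (MvPolynomial σ K) M]

variable (K M) in
/-- The generic point of affine space: the variables, as elements of the field of rational
functions. -/
noncomputable abbrev genericCoord (i : σ) : M := algebraMap (MvPolynomial σ K) M (X i)

theorem aeval_genericCoord_map {k : Type*} [Field k] [Algebra K k] [Algebra k M]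
    [IsScalarTower K k M] (r : MvPolynomial σ K) :
    aeval (genericCoord K M) (map (algebraMap K k) r) = algebraMap (MvPolynomial σ K) M r := by
  rw [aeval_map_algebraMap]
  have : aeval (genericCoord K M) = IsScalarTower.toAlgHom K (MvPolynomial σ K) M := by
    ext i; simp
  rw [this]; rfl

variable [IsFractionRing (MvPolynomial σ K) M]

/-- Coprimality makes `a + bX` primitive, so Gauss's lemma brings the root `-a/b` back from the
fraction field. -/
theorem linear_dvd_of_eval₂_eq_zero {A : Type*} [CommRing A] [IsDomain A]
    [UniqueFactorizationMonoid A] [Algebra A M] [IsFractionRing A M] {a b : A} (hb : b ≠ 0)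
    (hab : IsRelPrime a b) {w : Polynomial A}
    (h : w.eval₂ (algebraMap A M) (-(algebraMap A M a / algebraMap A M b)) = 0) :
    Polynomial.C a + Polynomial.X * Polynomial.C b ∣ w := by
  have hprim : (Polynomial.C a + Polynomial.X * Polynomial.C b).IsPrimitive := by
    intro c hc
    rw [Polynomial.C_dvd_iff_dvd_coeff] at hc
    refine hab ?_ ?_
    · simpa using hc 0
    · simpa [Polynomial.coeff_C] using hc 1
  have hb' : algebraMap A M b ≠ 0 := by
    simpa using (IsFractionRing.injective A M).ne hb
  refine hprim.dvd_of_fraction_map_dvd_fraction_map (K := M) ?_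
  rw [← Polynomial.eval_map, ← Polynomial.IsRoot.def, ← Polynomial.dvd_iff_isRoot] at h
  have hu : IsUnit (Polynomial.C (algebraMap A M b)) := (isUnit_iff_ne_zero.2 hb').map Polynomial.C
  convert hu.mul_left_dvd.2 h using 1
  simp only [Polynomial.map_add, Polynomial.map_mul, Polynomial.map_C, Polynomial.map_X, mul_sub,
    ← Polynomial.C_mul, mul_neg, mul_div_cancel₀ _ hb', Polynomial.C_neg]
  ring

variable {φ ψ : MvPolynomial σ K}

/-- The relations satisfied by the generic point over `K(f)`, `f = φ / ψ`. -/
theorem aeval_genericCoord_eq_zero_iff [Algebra (RatFunc K) M] [IsScalarTower K (RatFunc K) M]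
    (hψ : ψ ≠ 0) (hrel : IsRelPrime φ ψ)
    (hX : algebraMap (RatFunc K) M RatFunc.X =
      -(algebraMap (MvPolynomial σ K) M φ / algebraMap (MvPolynomial σ K) M ψ))
    (q : MvPolynomial σ (RatFunc K)) :
    aeval (genericCoord K M) q = 0 ↔
      map (algebraMap K (RatFunc K)) φ + C RatFunc.X * map (algebraMap K (RatFunc K)) ψ ∣ q := by
  have hψ' : algebraMap (MvPolynomial σ K) M ψ ≠ 0 := by
    simpa using (IsFractionRing.injective (MvPolynomial σ K) M).ne hψ
  constructor
  · intro h
    obtain ⟨a, ha, h', hh'⟩ := exists_C_mul_eq_map (A := Polynomial K) q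
    -- `Θ` and `Ψ` pass between `K[λ][y]` and `K[y][λ]`: read in `λ`, the relation has the root
    -- `-φ/ψ`, and the generator is linear.
    let Θ : MvPolynomial σ (Polynomial K) →+* Polynomial (MvPolynomial σ K) :=
      eval₂Hom (Polynomial.mapRingHom C) fun i ↦ Polynomial.C (X i)
    let Ψ : Polynomial (MvPolynomial σ K) →+* MvPolynomial σ (Polynomial K) :=
      Polynomial.eval₂RingHom (map Polynomial.C) (C Polynomial.X)
    have hΨΘ : ∀ w, Ψ (Θ w) = w := by
      suffices Ψ.comp Θ = RingHom.id _ from fun w ↦ congrArg (fun f ↦ f w) this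
      ext <;> simp [Θ, Ψ]
    have heval : ∀ w, (Θ w).eval₂ (algebraMap (MvPolynomial σ K) M)
        (-(algebraMap (MvPolynomial σ K) M φ / algebraMap (MvPolynomial σ K) M ψ)) =
        aeval (genericCoord K M) (map (algebraMap (Polynomial K) (RatFunc K)) w) := by
      suffices (Polynomial.eval₂RingHom (algebraMap (MvPolynomial σ K) M)
        (-(algebraMap (MvPolynomial σ K) M φ / algebraMap (MvPolynomial σ K) M ψ))).comp Θ =
        (aeval (R := RatFunc K) (genericCoord K M)).toRingHom.comp
          (map (algebraMap (Polynomial K) (RatFunc K))) from fun w ↦ congrArg (fun f ↦ f w) this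
      refine MvPolynomial.ringHom_ext' (Polynomial.ringHom_ext (fun c ↦ ?_) ?_) fun i ↦ ?_
      · have h1 : algebraMap (MvPolynomial σ K) M (C c) =
            algebraMap (RatFunc K) M (algebraMap (Polynomial K) (RatFunc K) (Polynomial.C c)) := by
          rw [← MvPolynomial.algebraMap_eq, ← IsScalarTower.algebraMap_apply,
            ← Polynomial.algebraMap_eq, ← IsScalarTower.algebraMap_apply K (Polynomial K) (RatFunc K),
            ← IsScalarTower.algebraMap_apply]
        simpa [Θ] using h1
      · simp [Θ, hX]
      · simp [Θ]
    have hdvd : Polynomial.C φ + Polynomial.X * Polynomial.C ψ ∣ Θ h' := by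
      refine linear_dvd_of_eval₂_eq_zero (M := M) hψ hrel ?_
      rw [heval, ← hh', map_mul, h, mul_zero]
    have h2 := _root_.map_dvd (map (algebraMap (Polynomial K) (RatFunc K))) (_root_.map_dvd Ψ hdvd)
    rw [hΨΘ, ← hh'] at h2
    have hu : IsUnit (C (σ := σ) (algebraMap (Polynomial K) (RatFunc K) a)) :=
      (isUnit_iff_ne_zero.2 (by simpa using ha)).map C
    rw [hu.dvd_mul_left] at h2
    convert h2 using 1
    simp only [Ψ, map_add, map_mul, Polynomial.coe_eval₂RingHom, Polynomial.eval₂_C,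
      Polynomial.eval₂_X, map_map, map_C]
    rw [RatFunc.algebraMap_X]
    rfl
  · rintro ⟨c, rfl⟩
    rw [map_mul, map_add, map_mul, aeval_genericCoord_map, aeval_genericCoord_map, aeval_C, hX]
    field_simp
    simp

end Relations

theorem map_algebraMap_ne_zero {K σ M : Type*} [Field K] [Field M] [Algebra (MvPolynomial σ K) M]
    [IsFractionRing (MvPolynomial σ K) M] {s : MvPolynomial σ K} (hs : s ≠ 0) :
    algebraMap (MvPolynomial σ K) M s ≠ 0 := by
  simpa using (IsFractionRing.injective (MvPolynomial σ K) M).ne hs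

/-! ### Lüroth's argument for the relation ideal over `E` -/

section Luroth

variable {K σ M E : Type*} [Field K] [Field M] [Field E] [Algebra (MvPolynomial σ K) M]
  [Algebra K M] [IsScalarTower K (MvPolynomial σ K) M] [Algebra K E] [Algebra E M]
  [IsScalarTower K E M] [IsFractionRing (MvPolynomial σ K) M]

/-- The polynomial `r(y) - g s(y)`. -/
noncomputable def fiberPoly (r s : MvPolynomial σ K) (g : E) : MvPolynomial σ E :=
  map (algebraMap K E) r - C g * map (algebraMap K E) s

theorem C_mul_map_fiberPoly {r s : MvPolynomial σ K} {g : E} (hs : s ≠ 0)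
    (hg : algebraMap E M g =
      algebraMap (MvPolynomial σ K) M r / algebraMap (MvPolynomial σ K) M s) :
    C (algebraMap (MvPolynomial σ K) M s) * map (algebraMap E M) (fiberPoly r s g) =
      map (algebraMap (MvPolynomial σ K) M) (crossDiff r s) := by
  have hs' := map_algebraMap_ne_zero (M := M) hs
  have hC : (algebraMap (MvPolynomial σ K) M).comp C = algebraMap K M :=
    (IsScalarTower.algebraMap_eq K (MvPolynomial σ K) M).symm
  simp only [fiberPoly, crossDiff, map_sub, map_mul, map_C, map_map, hg, hC,
    ← IsScalarTower.algebraMap_eq]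
  rw [mul_sub, ← mul_assoc, ← C_mul, mul_div_cancel₀ _ hs']

theorem associated_map_fiberPoly {r s : MvPolynomial σ K} {g : E} (hs : s ≠ 0)
    (hg : algebraMap E M g =
      algebraMap (MvPolynomial σ K) M r / algebraMap (MvPolynomial σ K) M s) :
    Associated (map (algebraMap E M) (fiberPoly r s g))
      (map (algebraMap (MvPolynomial σ K) M) (crossDiff r s)) := by
  rw [← C_mul_map_fiberPoly hs hg]
  exact (associated_unit_mul_left _ _
    ((isUnit_iff_ne_zero.2 (map_algebraMap_ne_zero (M := M) hs)).map C)).symm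

theorem aeval_fiberPoly {r s : MvPolynomial σ K} {g : E} (hs : s ≠ 0)
    (hg : algebraMap E M g =
      algebraMap (MvPolynomial σ K) M r / algebraMap (MvPolynomial σ K) M s) :
    aeval (genericCoord K M) (fiberPoly r s g) = 0 := by
  have hs' := map_algebraMap_ne_zero (M := M) hs
  rw [fiberPoly, map_sub, map_mul, aeval_genericCoord_map, aeval_genericCoord_map, aeval_C, hg,
    div_mul_cancel₀ _ hs', sub_self]

/-- If the relations of the generic point over `E` are generated by `G`, then they are generated by
`r(y) - g s(y)` for some nonconstant `g = r / s` in `E`. -/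
theorem exists_fiberPoly_generator (G : MvPolynomial σ E) (hG0 : G ≠ 0)
    (hG : ∀ q, aeval (genericCoord K M) q = 0 ↔ G ∣ q) :
    ∃ (r s : MvPolynomial σ K) (g : E), IsRelPrime r s ∧ s ≠ 0 ∧ (∀ c, r ≠ C c * s) ∧
      algebraMap E M g =
        algebraMap (MvPolynomial σ K) M r / algebraMap (MvPolynomial σ K) M s ∧
      ∀ q, aeval (genericCoord K M) q = 0 ↔ fiberPoly r s g ∣ q := by
  have hinj := IsFractionRing.injective (MvPolynomial σ K) M
  have hGM : map (algebraMap E M) G ≠ 0 := by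
    rwa [Ne, map_eq_zero_iff _ (map_injective _ (algebraMap E M).injective)]
  obtain ⟨a, ha, G₁, hG₁⟩ := exists_C_mul_eq_map (A := MvPolynomial σ K) (map (algebraMap E M) G)
  have ha' := map_algebraMap_ne_zero (M := M) ha
  have hG₁0 : G₁ ≠ 0 := by
    rintro rfl
    rw [map_zero] at hG₁
    exact mul_ne_zero (by simpa using ha') hGM hG₁
  obtain ⟨b, G', rfl, hprim⟩ := exists_eq_C_mul_primitive hG₁0
  have hb : b ≠ 0 := by rintro rfl; simp at hG₁0
  have hG'0 : G' ≠ 0 := by rintro rfl; simp at hG₁0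
  have hb' := map_algebraMap_ne_zero (M := M) hb
  rw [map_mul, map_C] at hG₁
  have hassoc : Associated (map (algebraMap E M) G) (map (algebraMap (MvPolynomial σ K) M) G') := by
    have h1 := (associated_unit_mul_left (map (algebraMap E M) G) _
      ((isUnit_iff_ne_zero.2 ha').map C)).symm
    rw [hG₁] at h1
    exact h1.trans (associated_unit_mul_left _ _ ((isUnit_iff_ne_zero.2 hb').map C))
  have hG'x : aeval (genericCoord K M) (map (algebraMap (MvPolynomial σ K) M) G') = 0 := by
    have h1 := congrArg (aeval (genericCoord K M)) hG₁
    rw [map_mul, map_mul, aeval_map_algebraMap, (hG G).2 dvd_rfl, mul_zero, aeval_C] at h1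
    exact (mul_eq_zero.1 h1.symm).resolve_left hb'
  obtain ⟨m₀, hm₀⟩ := ne_zero_iff.1 hG'0
  -- If all coefficients were `K`-multiples of one of them, the generic point would satisfy a
  -- nonzero polynomial over `K`. So some coefficient ratio is nonconstant, and in lowest terms it
  -- is `g = r/s`.
  obtain ⟨m₁, hm₁⟩ : ∃ m₁, ∀ c, coeff m₁ G' ≠ C c * coeff m₀ G' := by
    by_contra! h
    choose c hc using h
    let k : MvPolynomial σ K := ∑ m ∈ G'.support, monomial m (c m)
    have hk : G' = C (coeff m₀ G') * map C k := by
      conv_lhs => rw [G'.as_sum]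
      simp only [k, map_sum, map_monomial, Finset.mul_sum, C_mul_monomial]
      exact Finset.sum_congr rfl fun m _ ↦ by rw [hc m, mul_comm]
    have h1 := hG'x
    rw [hk, map_mul, map_mul, map_C, aeval_C, map_map, ← MvPolynomial.algebraMap_eq,
      ← IsScalarTower.algebraMap_eq, aeval_genericCoord_map] at h1
    have h2 := (mul_eq_zero.1 h1).resolve_left (map_algebraMap_ne_zero (M := M) hm₀)
    have h3 : k = 0 := by
      rwa [map_eq_zero_iff _ hinj] at h2
    exact hG'0 (by rw [hk, h3, map_zero, mul_zero])
  obtain ⟨r, s, d, hrel, hr, hs⟩ :=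
    UniqueFactorizationMonoid.exists_reduced_factors' (coeff m₁ G') (coeff m₀ G') hm₀
  have hd0 : d ≠ 0 := by rintro rfl; rw [zero_mul] at hs; exact hm₀ hs.symm
  have hs0 : s ≠ 0 := by rintro rfl; rw [mul_zero] at hs; exact hm₀ hs.symm
  have hrs : ∀ c, r ≠ C c * s := by
    rintro c rfl
    exact hm₁ c (by rw [← hr, ← hs]; ring)
  have hcoeff : ∀ m, algebraMap (MvPolynomial σ K) M a * algebraMap E M (coeff m G) =
      algebraMap (MvPolynomial σ K) M b * algebraMap (MvPolynomial σ K) M (coeff m G') := by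
    intro m
    simpa [coeff_C_mul, coeff_map] using congrArg (coeff m) hG₁
  have hg : algebraMap E M (coeff m₁ G / coeff m₀ G) =
      algebraMap (MvPolynomial σ K) M r / algebraMap (MvPolynomial σ K) M s := by
    have hm₀' := map_algebraMap_ne_zero (M := M) hm₀
    have hG0' : algebraMap E M (coeff m₀ G) ≠ 0 := by
      intro h
      have := hcoeff m₀
      rw [h, mul_zero] at this
      exact mul_ne_zero hb' hm₀' this.symm
    have hs' := map_algebraMap_ne_zero (M := M) hs0
    have h0 := hcoeff m₀
    have h1 := hcoeff m₁
    rw [← hs, map_mul] at h0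
    rw [← hr, map_mul] at h1
    rw [map_div₀, div_eq_div_iff hG0' hs']
    refine mul_left_cancel₀ ha' ?_
    linear_combination algebraMap (MvPolynomial σ K) M s * h1 - algebraMap (MvPolynomial σ K) M r * h0
  refine ⟨r, s, coeff m₁ G / coeff m₀ G, hrel, hs0, hrs, hg, ?_⟩
  have hdvd : G ∣ fiberPoly r s (coeff m₁ G / coeff m₀ G) :=
    (hG _).1 (aeval_fiberPoly hs0 hg)
  have hF := associated_map_fiberPoly hs0 hg
  have hG'dvd : G' ∣ crossDiff r s := by
    refine dvd_of_map_dvd_map (M := M) hprim ?_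
    rw [← hassoc.dvd_iff_dvd_left, ← hF.dvd_iff_dvd_right]
    exact _root_.map_dvd _ hdvd
  -- Two coefficients of `G'` are `d * r` and `d * s`, so `G'` already has the full degree in `x` of
  -- its multiple `crossDiff r s`.
  have hcross : crossDiff r s ∣ G' := by
    have hmul : ∀ u : MvPolynomial σ K, u.totalDegree ≤ (d * u).totalDegree := by
      intro u
      by_cases hu : u = 0
      · simp [hu]
      · rw [totalDegree_mul_of_isDomain hd0 hu]
        exact Nat.le_add_left _ _
    refine crossDiff_dvd_of_dvd hrel hs0 hrs hG'dvd (max_le ?_ ?_)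
    · exact (hmul r).trans (hr ▸ totalDegree_coeff_le_swapVars G' m₁)
    · exact (hmul s).trans (hs ▸ totalDegree_coeff_le_swapVars G' m₀)
  have hdvd' : fiberPoly r s (coeff m₁ G / coeff m₀ G) ∣ G := by
    refine dvd_of_dvd_of_map_dvd (M := M) hG0 hdvd ?_
    rw [hassoc.dvd_iff_dvd_right, hF.dvd_iff_dvd_left]
    exact _root_.map_dvd _ hcross
  intro q
  rw [hG]
  exact ⟨fun h ↦ hdvd'.trans h, fun h ↦ hdvd.trans h⟩

/-- Suppose that `f = φ / ψ` and `g = r / s` and that `r(y) - g s(y)` divides `φ(y) - f ψ(y)`. Then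
the degree of `g` is at most that of `f`, and in the case of equality both polynomials generate the
same ideal. -/
theorem degree_le_of_fiberPoly_dvd {r s φ ψ : MvPolynomial σ K} {g f : E}
    (hrel : IsRelPrime r s) (hs : s ≠ 0) (hrs : ∀ c, r ≠ C c * s)
    (hg : algebraMap E M g =
      algebraMap (MvPolynomial σ K) M r / algebraMap (MvPolynomial σ K) M s)
    (hrel' : IsRelPrime φ ψ) (hψ : ψ ≠ 0) (hφψ : ∀ c, φ ≠ C c * ψ)
    (hf : algebraMap E M f =
      algebraMap (MvPolynomial σ K) M φ / algebraMap (MvPolynomial σ K) M ψ)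
    (h : fiberPoly r s g ∣ fiberPoly φ ψ f) :
    max r.totalDegree s.totalDegree ≤ max φ.totalDegree ψ.totalDegree ∧
      (max r.totalDegree s.totalDegree = max φ.totalDegree ψ.totalDegree →
        fiberPoly φ ψ f ∣ fiberPoly r s g) := by
  have hF := associated_map_fiberPoly hs hg
  have hF' := associated_map_fiberPoly hψ hf
  have hne : ∀ {r s : MvPolynomial σ K}, s ≠ 0 → (∀ c, r ≠ C c * s) → crossDiff r s ≠ 0 := by
    intro r s hs hrs
    obtain ⟨m, hm⟩ := ne_zero_iff.1 hs
    exact ne_zero_iff.2 ⟨m, coeff_crossDiff_ne_zero hrs hs (.inr hm)⟩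
  have hdvd : crossDiff r s ∣ crossDiff φ ψ := by
    refine dvd_of_map_dvd_map (M := M)
      (fun π hπ hd ↦ hπ.not_isUnit (isUnit_of_C_dvd_crossDiff hrel hs hrs hd)) ?_
    rw [← hF.dvd_iff_dvd_left, ← hF'.dvd_iff_dvd_right]
    exact _root_.map_dvd _ h
  refine ⟨?_, fun heq ↦ ?_⟩
  · obtain ⟨Q, hQ⟩ := hdvd
    have h0 := hne hψ hφψ
    have hQ0 : Q ≠ 0 := by
      rintro rfl
      exact h0 (by rw [hQ, mul_zero])
    have hd := congrArg (fun G ↦ (swapVars G).totalDegree) hQ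
    simp only [map_mul] at hd
    rw [totalDegree_mul_of_isDomain (by simpa using hne hs hrs) (by simpa using hQ0),
      totalDegree_swapVars_crossDiff hrs hs, totalDegree_swapVars_crossDiff hφψ hψ] at hd
    omega
  · refine dvd_of_dvd_of_map_dvd (M := M) ?_ h ?_
    · intro h0
      have := C_mul_map_fiberPoly hs hg
      rw [h0, map_zero, mul_zero, eq_comm, map_eq_zero_iff _
        (map_injective _ (IsFractionRing.injective _ M))] at this
      exact hne hs hrs this
    · rw [hF'.dvd_iff_dvd_left, hF.dvd_iff_dvd_right]
      refine _root_.map_dvd _ (crossDiff_dvd_of_dvd hrel' hψ hφψ hdvd ?_)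
      rw [totalDegree_swapVars_crossDiff hrs hs, heq]

end Luroth

/-! ### From divisibility to rational dependence -/

/-- A linear functional applied to the coefficients of a product. -/
theorem exists_map_linear {k M σ : Type*} [Field k] [Field M] [Algebra k M] (l : M →ₗ[k] k) :
    ∃ L : MvPolynomial σ M → MvPolynomial σ k, (∀ q m, coeff m (L q) = l (coeff m q)) ∧
      ∀ p q, L (map (algebraMap k M) p * q) = p * L q := by
  classical
  have h : ∀ q : MvPolynomial σ M, ∃ q' : MvPolynomial σ k, ∀ m, coeff m q' = l (coeff m q) := by
    intro q
    refine ⟨∑ m ∈ q.support, monomial m (l (coeff m q)), fun m ↦ ?_⟩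
    simp only [coeff_sum, coeff_monomial, Finset.sum_ite_eq', mem_support_iff]
    split_ifs with h
    · rfl
    · rw [not_ne_iff.1 h, map_zero]
  choose L hL using h
  refine ⟨L, hL, fun p q ↦ ?_⟩
  ext m
  simp only [hL, coeff_mul, map_sum, coeff_map]
  refine Finset.sum_congr rfl fun a _ ↦ ?_
  rw [← Algebra.smul_def, map_smul, smul_eq_mul]

/-- If `r(y) - g s(y)` divides `φ(y) - f ψ(y)`, with `ψ ≠ 0`, then `f` is a rational
function of `g`. -/
theorem mem_adjoin_of_fiberPoly_dvd {K M σ : Type*} [Field K] [Field M]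
    [Algebra (MvPolynomial σ K) M] [Algebra K M] [IsScalarTower K (MvPolynomial σ K) M]
    [IsFractionRing (MvPolynomial σ K) M]
    {r s φ ψ : MvPolynomial σ K} {f g : M} (hs : s ≠ 0) (hψ : ψ ≠ 0)
    (hg : g = algebraMap (MvPolynomial σ K) M r / algebraMap (MvPolynomial σ K) M s)
    (h : fiberPoly r s g ∣ fiberPoly φ ψ f) : f ∈ IntermediateField.adjoin K {g} := by
  by_contra hf
  let k := IntermediateField.adjoin K {g}
  let g' : k := ⟨g, IntermediateField.mem_adjoin_simple_self K g⟩
  have hg' : algebraMap k M g' = g := rfl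
  have hli : f ∉ Submodule.span k {(1 : M)} := by
    rw [Submodule.mem_span_singleton]
    rintro ⟨a, rfl⟩
    refine hf ?_
    rw [Algebra.smul_def, mul_one]
    exact a.2
  -- A `K(g)`-linear functional killing 1 but not `f` turns the divisibility into one of `-l(f)
  -- ψ(y)` by `r(y) - g s(y)` over `K(g)`. At the generic point the divisor vanishes and `ψ` does
  -- not.
  obtain ⟨l, hl', hl⟩ := Submodule.exists_le_ker_of_notMem hli
  obtain ⟨L, hL, hLmul⟩ := exists_map_linear (σ := σ) l
  obtain ⟨Q, hQ⟩ := h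
  have hmap : fiberPoly r s g = map (algebraMap k M) (fiberPoly r s g') := by
    simp only [fiberPoly, map_sub, map_mul, map_C, map_map, hg', ← IsScalarTower.algebraMap_eq]
  have h1 : L (fiberPoly φ ψ f) = C (-l f) * map (algebraMap K k) ψ := by
    have hl1 : ∀ c : K, l (algebraMap K M c) = 0 := by
      intro c
      have : algebraMap K M c ∈ Submodule.span k {(1 : M)} :=
        Submodule.mem_span_singleton.2 ⟨algebraMap K k c, by
          rw [Algebra.smul_def, mul_one, ← IsScalarTower.algebraMap_apply]⟩
      exact hl this
    ext m
    rw [hL, fiberPoly, coeff_sub, coeff_C_mul, coeff_C_mul, coeff_map, coeff_map, coeff_map,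
      map_sub, hl1, IsScalarTower.algebraMap_apply K k M, mul_comm f, ← Algebra.smul_def, map_smul,
      smul_eq_mul, zero_sub, neg_mul, mul_comm]
  have h2 : C (-l f) * map (algebraMap K k) ψ = fiberPoly r s g' * L Q := by
    rw [← h1, hQ, hmap, hLmul]
  have h3 := congrArg (aeval (genericCoord K M)) h2
  rw [map_mul, map_mul, aeval_fiberPoly hs (hg'.trans hg), zero_mul, aeval_genericCoord_map,
    aeval_C] at h3
  refine mul_ne_zero ?_ (map_algebraMap_ne_zero hψ) h3
  simpa using hl'

/-! ### Binary forms, and rational functions of `r/s` in lowest terms -/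

/-- The form of degree `e` in two variables obtained by homogenizing `u`. -/
noncomputable def binaryForm {K : Type*} [Field K] (e : ℕ) (u : Polynomial K) :
    MvPolynomial (Fin 2) K :=
  ∑ i ∈ Finset.range (e + 1), C (u.coeff i) * (X 0 ^ i * X 1 ^ (e - i))

theorem isHomogeneous_binaryForm {K : Type*} [Field K] (e : ℕ) (u : Polynomial K) :
    (binaryForm e u).IsHomogeneous e := by
  refine IsHomogeneous.sum _ _ _ fun i hi ↦ ?_
  have h : e = i + (e - i) := by
    have := Finset.mem_range.1 hi
    omega
  have := ((isHomogeneous_X_pow (R := K) (0 : Fin 2) i).mul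
    (isHomogeneous_X_pow (R := K) (1 : Fin 2) (e - i))).C_mul (u.coeff i)
  rwa [← h] at this

theorem aeval_binaryForm {K A : Type*} [Field K] [CommRing A] [Algebra K A] (e : ℕ)
    (u : Polynomial K) (r s : A) : aeval ![r, s] (binaryForm e u) =
      ∑ i ∈ Finset.range (e + 1), algebraMap K A (u.coeff i) * (r ^ i * s ^ (e - i)) := by
  simp [binaryForm]

theorem aeval_binaryForm_eq {K F : Type*} [Field K] [Field F] [Algebra K F] {e : ℕ}
    {u : Polynomial K} (hu : u.natDegree ≤ e) (r s : F) (hs : s ≠ 0) :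
    aeval ![r, s] (binaryForm e u) = s ^ e * Polynomial.aeval (r / s) u := by
  rw [aeval_binaryForm, Polynomial.aeval_eq_sum_range' (Nat.lt_succ_of_le hu), Finset.mul_sum]
  refine Finset.sum_congr rfl fun i hi ↦ ?_
  have h : e = i + (e - i) := by
    have := Finset.mem_range.1 hi
    omega
  rw [Algebra.smul_def, div_pow]
  conv_rhs => rw [h, pow_add]
  field_simp

theorem map_aeval_pair {K A B : Type*} [Field K] [CommRing A] [CommRing B] [Algebra K A]
    [Algebra K B] (j : A →ₐ[K] B) (h : MvPolynomial (Fin 2) K) (r s : A) :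
    j (aeval ![r, s] h) = aeval ![j r, j s] h := by
  have : j.comp (aeval ![r, s]) = aeval ![j r, j s] := by
    ext i
    fin_cases i <;> simp
  exact congrArg (fun f ↦ f h) this

theorem dvd_aeval_binaryForm_sub {K A : Type*} [Field K] [CommRing A] [Algebra K A] (e : ℕ)
    (u : Polynomial K) (r s : A) :
    s ∣ aeval ![r, s] (binaryForm e u) - algebraMap K A (u.coeff e) * r ^ e := by
  rw [aeval_binaryForm, Finset.sum_range_succ, Nat.sub_self, pow_zero, mul_one, add_sub_cancel_right]
  refine Finset.dvd_sum fun i hi ↦ Dvd.dvd.mul_left (Dvd.dvd.mul_left (dvd_pow_self s ?_) _) _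
  have := Finset.mem_range.1 hi
  omega

/-- Coprime binary forms in coprime elements are coprime. -/
theorem isRelPrime_aeval_binaryForm {K A : Type*} [Field K] [CommRing A] [IsDomain A]
    [UniqueFactorizationMonoid A] [Algebra K A] {u w : Polynomial K} (huw : IsCoprime u w)
    {r s : A} (hrs : IsRelPrime r s)
    (hne : aeval ![r, s] (binaryForm (max u.natDegree w.natDegree) w) ≠ 0) :
    IsRelPrime (aeval ![r, s] (binaryForm (max u.natDegree w.natDegree) u))
      (aeval ![r, s] (binaryForm (max u.natDegree w.natDegree) w)) := by
  set e := max u.natDegree w.natDegree with he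
  intro m hmu hmw
  by_contra hm
  have hm0 : m ≠ 0 := by rintro rfl; exact hne (zero_dvd_iff.1 hmw)
  obtain ⟨π, hπ, hπm⟩ := WfDvdMonoid.exists_irreducible_factor hm hm0
  have hπ' := hπ.prime
  have hu := hπm.trans hmu
  have hw := hπm.trans hmw
  -- If `π` divides `s`, only the `r ^ e` terms survive modulo `π`, and one of `u`, `w` has nonzero
  -- coefficient there. Otherwise `r/s` modulo `π` is a common root of `u` and `w`, against Bézout.
  by_cases hs : π ∣ s
  · have key : ∀ u : Polynomial K, u.coeff e ≠ 0 → π ∣ aeval ![r, s] (binaryForm e u) → π ∣ r := by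
      intro u hue hu
      have h1 := dvd_sub hu (hs.trans (dvd_aeval_binaryForm_sub e u r s))
      rw [sub_sub_cancel, ((isUnit_iff_ne_zero.2 hue).map (algebraMap K A)).dvd_mul_left] at h1
      exact hπ'.dvd_of_dvd_pow h1
    refine hπ.not_isUnit (hrs ?_ hs)
    by_cases hue : u.coeff e = 0
    · by_cases hwe : w.coeff e = 0
      · exfalso
        rcases max_choice u.natDegree w.natDegree with h | h
        · rw [he, h, Polynomial.coeff_natDegree, Polynomial.leadingCoeff_eq_zero] at hue
          subst hue
          have : w.natDegree = e := by simp [he]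
          rw [← this, Polynomial.coeff_natDegree, Polynomial.leadingCoeff_eq_zero] at hwe
          subst hwe
          exact not_isCoprime_zero_zero huw
        · rw [he, h, Polynomial.coeff_natDegree, Polynomial.leadingCoeff_eq_zero] at hwe
          subst hwe
          have : u.natDegree = e := by simp [he]
          rw [← this, Polynomial.coeff_natDegree, Polynomial.leadingCoeff_eq_zero] at hue
          subst hue
          exact not_isCoprime_zero_zero huw
      · exact key w hwe hw
    · exact key u hue hu
  · have : (Ideal.span {π}).IsPrime := (Ideal.span_singleton_prime hπ'.ne_zero).2 hπ'
    let F := FractionRing (A ⧸ Ideal.span {π})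
    let j : A →ₐ[K] F := (IsScalarTower.toAlgHom K (A ⧸ Ideal.span {π}) F).comp
      (Ideal.Quotient.mkₐ K (Ideal.span {π}))
    have hj : ∀ a, j a = 0 ↔ π ∣ a := by
      intro a
      change algebraMap (A ⧸ Ideal.span {π}) F (Ideal.Quotient.mk _ a) = 0 ↔ _
      rw [map_eq_zero_iff _ (IsFractionRing.injective (A ⧸ Ideal.span {π}) F),
        Ideal.Quotient.eq_zero_iff_mem, Ideal.mem_span_singleton]
    have hjs : j s ≠ 0 := by rwa [Ne, hj]
    have key : ∀ u : Polynomial K, u.natDegree ≤ e → π ∣ aeval ![r, s] (binaryForm e u) →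
        Polynomial.aeval (j r / j s) u = 0 := by
      intro u hue hu
      rw [← hj, map_aeval_pair, aeval_binaryForm_eq hue _ _ hjs] at hu
      exact (mul_eq_zero.1 hu).resolve_left (pow_ne_zero _ hjs)
    obtain ⟨α, β, hαβ⟩ := huw
    have h1 := congrArg (Polynomial.aeval (j r / j s)) hαβ
    rw [map_add, map_mul, map_mul, key u (le_max_left _ _) hu, key w (le_max_right _ _) hw] at h1
    simp at h1

/-- If `φ / ψ` is a rational function of `r / s` then `φ` and `ψ` are forms of the same degree in
`r` and `s`. -/
theorem exists_forms_of_mem_adjoin {K M σ : Type*} [Field K] [Field M]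
    [Algebra (MvPolynomial σ K) M] [Algebra K M] [IsScalarTower K (MvPolynomial σ K) M]
    [IsFractionRing (MvPolynomial σ K) M] {r s φ ψ : MvPolynomial σ K}
    (hrel : IsRelPrime r s) (hs : s ≠ 0) (hrel' : IsRelPrime φ ψ) (hψ : ψ ≠ 0)
    (h : algebraMap (MvPolynomial σ K) M φ / algebraMap (MvPolynomial σ K) M ψ ∈
      IntermediateField.adjoin K
        {algebraMap (MvPolynomial σ K) M r / algebraMap (MvPolynomial σ K) M s}) :
    ∃ (e : ℕ) (h₁ h₂ : MvPolynomial (Fin 2) K), h₁.IsHomogeneous e ∧ h₂.IsHomogeneous e ∧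
      φ = aeval ![r, s] h₁ ∧ ψ = aeval ![r, s] h₂ := by
  classical
  have hinj := IsFractionRing.injective (MvPolynomial σ K) M
  have hs' := map_algebraMap_ne_zero (M := M) hs
  have hψ' := map_algebraMap_ne_zero (M := M) hψ
  set f := algebraMap (MvPolynomial σ K) M φ / algebraMap (MvPolynomial σ K) M ψ with hf
  set g := algebraMap (MvPolynomial σ K) M r / algebraMap (MvPolynomial σ K) M s with hg
  obtain ⟨u, w, huw, hwg, hfuw⟩ : ∃ u w : Polynomial K, IsCoprime u w ∧
      Polynomial.aeval g w ≠ 0 ∧ f = Polynomial.aeval g u / Polynomial.aeval g w := by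
    obtain ⟨u, w, huw⟩ := (IntermediateField.mem_adjoin_simple_iff K f).1 h
    by_cases hwg : Polynomial.aeval g w = 0
    -- Division by zero gives `f = 0` here, represented by `0/1`.
    · refine ⟨0, 1, isCoprime_one_right, by simp, ?_⟩
      rw [huw, hwg, div_zero, map_zero, zero_div]
    · have hw : w ≠ 0 := by rintro rfl; simp at hwg
      obtain ⟨u', hu'⟩ := EuclideanDomain.gcd_dvd_left u w
      obtain ⟨w', hw'⟩ := EuclideanDomain.gcd_dvd_right u w
      have hd : EuclideanDomain.gcd u w ≠ 0 := fun h0 ↦ hw (EuclideanDomain.gcd_eq_zero_iff.1 h0).2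
      set d := EuclideanDomain.gcd u w with hd'
      have hwg' := hwg
      rw [hw', map_mul] at hwg'
      refine ⟨u', w', ?_, right_ne_zero_of_mul hwg', ?_⟩
      · refine ⟨EuclideanDomain.gcdA u w, EuclideanDomain.gcdB u w, mul_left_cancel₀ hd ?_⟩
        have hb := EuclideanDomain.gcd_eq_gcd_ab u w
        rw [← hd'] at hb
        calc _ = (d * u') * EuclideanDomain.gcdA u w + (d * w') * EuclideanDomain.gcdB u w := by ring
          _ = d * 1 := by rw [← hu', ← hw', ← hb, mul_one]
      · rw [huw, hu', hw', map_mul, map_mul, mul_div_mul_left _ _ (left_ne_zero_of_mul hwg')]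
  let j := IsScalarTower.toAlgHom K (MvPolynomial σ K) M
  set e := max u.natDegree w.natDegree with he
  have hj : ∀ u : Polynomial K, u.natDegree ≤ e →
      algebraMap (MvPolynomial σ K) M (aeval ![r, s] (binaryForm e u)) =
        algebraMap (MvPolynomial σ K) M s ^ e * Polynomial.aeval g u := by
    intro u hu
    change j _ = _
    rw [map_aeval_pair]
    exact aeval_binaryForm_eq hu _ _ hs'
  have hU := hj u (le_max_left _ _)
  have hW := hj w (le_max_right _ _)
  have hW0 : aeval ![r, s] (binaryForm e w) ≠ 0 := by
    intro h0
    rw [h0, map_zero] at hW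
    exact mul_ne_zero (pow_ne_zero _ hs') hwg hW.symm
  have hrelUW := isRelPrime_aeval_binaryForm huw hrel hW0
  rw [← he] at hrelUW
  have hcross : φ * aeval ![r, s] (binaryForm e w) = aeval ![r, s] (binaryForm e u) * ψ := by
    refine hinj ?_
    rw [map_mul, map_mul, hU, hW]
    rw [hf, div_eq_div_iff hψ' hwg] at hfuw
    linear_combination algebraMap (MvPolynomial σ K) M s ^ e * hfuw
  obtain ⟨m, hm⟩ : ψ ∣ aeval ![r, s] (binaryForm e w) :=
    hrel'.symm.dvd_of_dvd_mul_left ⟨_, hcross.trans (mul_comm _ _)⟩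
  have hm' : aeval ![r, s] (binaryForm e u) = φ * m := by
    refine mul_right_cancel₀ hψ ?_
    rw [← hcross, hm]
    ring
  -- Coprimality of `φ`, `ψ` makes the homogenized `u`, `w` equal to `φ * m`, `ψ * m`; their own
  -- coprimality makes `m` a constant, absorbed into the forms.
  have hmu : IsUnit m := hrelUW ⟨φ, by rw [hm', mul_comm]⟩ ⟨ψ, by rw [hm, mul_comm]⟩
  obtain ⟨c, hc, rfl⟩ := (isUnit_iff_eq_C_of_isReduced).1 hmu
  have hc0 : c ≠ 0 := hc.ne_zero
  refine ⟨e, C c⁻¹ * binaryForm e u, C c⁻¹ * binaryForm e w,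
    (isHomogeneous_binaryForm e u).C_mul _, (isHomogeneous_binaryForm e w).C_mul _, ?_, ?_⟩
  · rw [map_mul, hm', aeval_C, MvPolynomial.algebraMap_eq, mul_comm φ, ← mul_assoc, ← C_mul,
      inv_mul_cancel₀ hc0, C_1, one_mul]
  · rw [map_mul, hm, aeval_C, MvPolynomial.algebraMap_eq, mul_comm ψ, ← mul_assoc, ← C_mul,
      inv_mul_cancel₀ hc0, C_1, one_mul]

/-! ### Degree bounds and vanishing derivatives -/

theorem totalDegree_aeval_pair_le {K σ : Type*} [Field K] {h : MvPolynomial (Fin 2) K} {e : ℕ}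
    (hh : h.IsHomogeneous e) (r s : MvPolynomial σ K) :
    (aeval ![r, s] h).totalDegree ≤ e * max r.totalDegree s.totalDegree := by
  rw [aeval_def, eval₂_eq']
  refine totalDegree_finsetSum_le fun m hm ↦ ?_
  have hme : m 0 + m 1 = e := by
    have := hh (mem_support_iff.1 hm)
    rw [← this, Finsupp.weight_apply, Finsupp.sum_fintype _ _ (by simp)]
    simp [Fin.sum_univ_two]
  rw [Fin.prod_univ_two, MvPolynomial.algebraMap_eq]
  refine (totalDegree_mul _ _).trans ?_
  rw [totalDegree_C, zero_add]
  refine (totalDegree_mul _ _).trans ?_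
  rw [← hme, add_mul]
  exact add_le_add
    ((totalDegree_pow _ _).trans (Nat.mul_le_mul_left _ (le_max_left _ _)))
    ((totalDegree_pow _ _).trans (Nat.mul_le_mul_left _ (le_max_right _ _)))

theorem natCast_eq_zero_of_pderiv_eq_zero {K σ : Type*} [Field K] {φ : MvPolynomial σ K} {i : σ}
    (h : pderiv i φ = 0) {m : σ →₀ ℕ} (hm : m ∈ φ.support) : (m i : K) = 0 := by
  classical
  by_cases hi : m i = 0
  · rw [hi, Nat.cast_zero]
  · have h1 := coeff_pderiv φ (i := i) (m - Finsupp.single i 1)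
    have h2 : m - Finsupp.single i 1 + Finsupp.single i 1 = m :=
      tsub_add_cancel_of_le (by simpa [Finsupp.single_le_iff] using Nat.one_le_iff_ne_zero.2 hi)
    rw [h, coeff_zero, h2] at h1
    have h3 := (mul_eq_zero.1 h1.symm).resolve_left (mem_support_iff.1 hm)
    rw [← h3, Finsupp.tsub_apply, Finsupp.single_eq_same]
    have : m i = m i - 1 + 1 := by omega
    conv_lhs => rw [this]
    push_cast
    rfl

/-- All exponents are divisible by `p`, and perfectness supplies `p`-th roots of the coefficients;
Frobenius is additive. -/
theorem exists_eq_pow_of_pderiv_eq_zero {K σ : Type*} [Field K] (p : ℕ) [hp : Fact p.Prime]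
    [CharP K p] [PerfectRing K p] {φ : MvPolynomial σ K} (h : ∀ i, pderiv i φ = 0) :
    ∃ φ₁, φ = φ₁ ^ p := by
  classical
  have hm : ∀ m ∈ φ.support, ∃ t, monomial m (coeff m φ) = frobenius (MvPolynomial σ K) p t := by
    intro m hm
    obtain ⟨c, hc⟩ := (PerfectRing.bijective_frobenius (R := K) (p := p)).2 (coeff m φ)
    refine ⟨monomial (m.mapRange (· / p) (Nat.zero_div p)) c, ?_⟩
    rw [frobenius_def, monomial_pow, ← hc]
    congr 2
    ext i
    have := (CharP.cast_eq_zero_iff K p _).1 (natCast_eq_zero_of_pderiv_eq_zero (h i) hm)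
    simp [Nat.mul_div_cancel' this]
  choose! t ht using hm
  refine ⟨∑ m ∈ φ.support, t m, ?_⟩
  rw [← frobenius_def, map_sum]
  conv_lhs => rw [φ.as_sum]
  exact Finset.sum_congr rfl ht

theorem totalDegree_eq_zero_of_isUnit {K σ : Type*} [Field K] {φ : MvPolynomial σ K}
    (h : IsUnit φ) : φ.totalDegree = 0 := by
  obtain ⟨c, -, rfl⟩ := isUnit_iff_eq_C_of_isReduced.1 h
  exact totalDegree_C c

theorem totalDegree_pow_eq_mul {K σ : Type*} [Field K] (φ : MvPolynomial σ K) (k : ℕ) :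
    (φ ^ k).totalDegree = k * φ.totalDegree := by
  by_cases hφ : φ = 0
  · cases k <;> simp [hφ]
  · induction k with
    | zero => simp
    | succ k ih => rw [pow_succ, totalDegree_mul_of_isDomain (pow_ne_zero k hφ) hφ, ih]; ring

/-! ### Non-maximal pairs are forms in a pair of lower degree -/

/-- A ring homomorphism `K(X) → M` sending `X` to a given element of `M ∖ K`. -/
theorem exists_ringHom_ratFunc {K M : Type*} [Field K] [IsAlgClosed K] [Field M] [Algebra K M]
    (t : M) (ht : t ∉ (algebraMap K M).range) :
    ∃ j : RatFunc K →+* M, j RatFunc.X = t ∧ ∀ c, j (algebraMap K (RatFunc K) c) = algebraMap K M c := by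
  -- Over an algebraically closed `K`, an element outside `K` is transcendental.
  have hinj : Function.Injective (Polynomial.aeval (R := K) t) := by
    refine (transcendental_iff_injective).1 fun hal ↦ ht ?_
    exact minpoly.mem_range_of_degree_eq_one K t
      (IsAlgClosed.degree_eq_one_of_irreducible K (minpoly.irreducible hal.isIntegral))
  refine ⟨IsFractionRing.lift (A := Polynomial K) (g := (Polynomial.aeval t).toRingHom) hinj, ?_, fun c ↦ ?_⟩
  · rw [← RatFunc.algebraMap_X, IsFractionRing.lift_algebraMap]
    simp
  · rw [IsScalarTower.algebraMap_apply K (Polynomial K) (RatFunc K), IsFractionRing.lift_algebraMap]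
    simp

/-- Generic reducibility of the pencil spanned by `φ` and `ψ` when some partial derivative is
nonzero, relative to the algebraic closure `E` of `K(φ / ψ)` in the field `M` of rational
functions. -/
theorem exists_forms_of_not_isMaximalPair_aux {K M E : Type*} [Field K] {n : ℕ} [Field M]
    [Algebra (MvPolynomial (Fin n) K) M] [IsFractionRing (MvPolynomial (Fin n) K) M] [Algebra K M]
    [IsScalarTower K (MvPolynomial (Fin n) K) M] [Algebra (RatFunc K) M]
    [IsScalarTower K (RatFunc K) M] [Field E] [Algebra K E] [Algebra (RatFunc K) E] [Algebra E M]
    [IsScalarTower K (RatFunc K) E] [IsScalarTower (RatFunc K) E M] [IsScalarTower K E M]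
    [Algebra.IsAlgebraic (RatFunc K) E]
    (hE : ∀ a : M, IsAlgebraic E a → a ∈ (algebraMap E M).range)
    {φ ψ : MvPolynomial (Fin n) K} (hrel : IsRelPrime φ ψ) (hψ : ψ ≠ 0) (hφψ : ∀ c, φ ≠ C c * ψ)
    (hX : algebraMap (RatFunc K) M RatFunc.X = -(algebraMap (MvPolynomial (Fin n) K) M φ /
      algebraMap (MvPolynomial (Fin n) K) M ψ))
    (hmax : ¬ HomDecomp.IsMaximalPair φ ψ) (i : Fin n) (hi : pderiv i φ ≠ 0 ∨ pderiv i ψ ≠ 0) :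
    ∃ (r s : MvPolynomial (Fin n) K) (e : ℕ) (h₁ h₂ : MvPolynomial (Fin 2) K),
      IsRelPrime r s ∧ max r.totalDegree s.totalDegree < max φ.totalDegree ψ.totalDegree ∧
      h₁.IsHomogeneous e ∧ h₂.IsHomogeneous e ∧ φ = aeval ![r, s] h₁ ∧ ψ = aeval ![r, s] h₂ := by
  have hψ' := map_algebraMap_ne_zero (M := M) hψ
  set f : M := algebraMap (MvPolynomial (Fin n) K) M φ / algebraMap (MvPolynomial (Fin n) K) M ψ
    with hf
  have hfK : ∀ c, algebraMap K M c ≠ f := by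
    intro c hc
    rw [hf, eq_div_iff hψ', IsScalarTower.algebraMap_apply K (MvPolynomial (Fin n) K) M,
      ← map_mul] at hc
    exact hφψ c (IsFractionRing.injective (MvPolynomial (Fin n) K) M hc).symm
  set fE : E := algebraMap (RatFunc K) E (-RatFunc.X) with hfE_def
  have hfE : algebraMap E M fE = f := by
    rw [← IsScalarTower.algebraMap_apply, map_neg, hX, neg_neg]
  let p : MvPolynomial (Fin n) (RatFunc K) :=
    map (algebraMap K (RatFunc K)) φ + C RatFunc.X * map (algebraMap K (RatFunc K)) ψ
  have hker := aeval_genericCoord_eq_zero_iff (M := M) hψ hrel hX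
  have hpE : map (algebraMap (RatFunc K) E) p = fiberPoly φ ψ fE := by
    simp only [p, hfE_def, fiberPoly, map_add, map_mul, map_map, map_C, map_neg,
      ← IsScalarTower.algebraMap_eq]
    ring
  -- Since `f` is not in `K`, the elements 1 and `f` are `K`-independent; this also keeps the
  -- derivative of `φ(y) - f ψ(y)` nonzero.
  have hcoeff : ∀ {a b : MvPolynomial (Fin n) K}, fiberPoly a b fE = 0 → a = 0 ∧ b = 0 := by
    intro a b hab
    have hm : ∀ m, algebraMap K M (coeff m a) = f * algebraMap K M (coeff m b) := by
      intro m
      have h1 := congrArg (fun P ↦ algebraMap E M (coeff m P)) hab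
      simp only [fiberPoly, coeff_sub, coeff_C_mul, coeff_map, coeff_zero, map_sub, map_mul,
        map_zero, hfE, ← IsScalarTower.algebraMap_apply] at h1
      exact sub_eq_zero.1 h1
    have hb : b = 0 := by
      ext m
      by_contra hbm
      rw [coeff_zero] at hbm
      refine hfK (coeff m a / coeff m b) ?_
      rw [map_div₀, hm, mul_div_cancel_right₀]
      simpa using hbm
    subst hb
    refine ⟨?_, rfl⟩
    ext m
    simpa using hm m
  have hp0 : p ≠ 0 := by
    intro h0
    rw [h0, map_zero] at hpE
    exact hψ (hcoeff hpE.symm).2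
  obtain ⟨G, hG, hGker⟩ := exists_irreducible_aeval_eq_zero_iff_dvd (k := E) _ p hp0 hker
  obtain ⟨r, s, g, hrs, hs, hrsC, hg, hgker⟩ := exists_fiberPoly_generator G hG.ne_zero hGker
  have hdvd : fiberPoly r s g ∣ fiberPoly φ ψ fE := (hgker _).1 (aeval_fiberPoly hψ hfE)
  obtain ⟨hle, heq⟩ := degree_le_of_fiberPoly_dvd hrs hs hrsC hg hrel hψ hφψ hfE hdvd
  rcases hle.lt_or_eq with hlt | heq'
  · have hmem : f ∈ IntermediateField.adjoin K {algebraMap E M g} := by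
      refine mem_adjoin_of_fiberPoly_dvd (r := r) (s := s) (φ := φ) (ψ := ψ) hs hψ hg ?_
      have hmap : ∀ (a b : MvPolynomial (Fin n) K) (g : E),
          map (algebraMap E M) (fiberPoly a b g) = fiberPoly a b (algebraMap E M g) := by
        intro a b g
        simp only [fiberPoly, map_sub, map_mul, map_C, map_map, ← IsScalarTower.algebraMap_eq]
      rw [← hfE, ← hmap, ← hmap]
      exact _root_.map_dvd _ hdvd
    rw [hg] at hmem
    obtain ⟨e, h₁, h₂, hh₁, hh₂, he₁, he₂⟩ := exists_forms_of_mem_adjoin hrs hs hrel hψ hmem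
    exact ⟨r, s, e, h₁, h₂, hrs, hlt, hh₁, hh₂, he₁, he₂⟩
  · exfalso
    refine hmax ?_
    have hker' : ∀ q, aeval (genericCoord K M) q = 0 ↔ fiberPoly φ ψ fE ∣ q := fun q ↦
      ⟨fun h ↦ (heq heq').trans ((hgker q).1 h), fun h ↦ (hgker q).2 (hdvd.trans h)⟩
    let L := AlgebraicClosure (RatFunc K)
    let ι : E →ₐ[RatFunc K] L := IsAlgClosed.lift
    let : Algebra E L := ι.toRingHom.toAlgebra
    have : IsScalarTower (RatFunc K) E L :=
      IsScalarTower.of_algebraMap_eq fun c ↦ (ι.commutes c).symm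
    have : Algebra.IsAlgebraic E L := Algebra.IsAlgebraic.tower_top (K := RatFunc K) E
    have hpd : pderiv i (fiberPoly φ ψ fE) ≠ 0 := by
      have : pderiv i (fiberPoly φ ψ fE) = fiberPoly (pderiv i φ) (pderiv i ψ) fE := by
        rw [fiberPoly, map_sub, pderiv_C_mul, pderiv_map, pderiv_map, fiberPoly]
      rw [this]
      intro h0
      have := hcoeff h0
      exact hi.elim (fun h ↦ h this.1) fun h ↦ h this.2
    have hirr := irreducible_map_of_aeval_eq_zero_iff_dvd (L := L) hE _ _ hker' i hpd
    rw [← hpE, map_map, ← IsScalarTower.algebraMap_eq] at hirr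
    simp only [p, map_add, map_mul, map_map, map_C, ← IsScalarTower.algebraMap_eq] at hirr
    exact hirr

/-- Generic reducibility of the pencil spanned by `φ` and `ψ` when some partial derivative is
nonzero. -/
theorem exists_forms_of_not_isMaximalPair_of_pderiv_ne_zero {K : Type*} [Field K] [IsAlgClosed K]
    {n : ℕ} {φ ψ : MvPolynomial (Fin n) K} (hrel : IsRelPrime φ ψ) (hψ : ψ ≠ 0)
    (hφψ : ∀ c, φ ≠ C c * ψ) (hmax : ¬ HomDecomp.IsMaximalPair φ ψ) (i : Fin n)
    (hi : pderiv i φ ≠ 0 ∨ pderiv i ψ ≠ 0) :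
    ∃ (r s : MvPolynomial (Fin n) K) (e : ℕ) (h₁ h₂ : MvPolynomial (Fin 2) K),
      IsRelPrime r s ∧ max r.totalDegree s.totalDegree < max φ.totalDegree ψ.totalDegree ∧
      h₁.IsHomogeneous e ∧ h₂.IsHomogeneous e ∧ φ = aeval ![r, s] h₁ ∧ ψ = aeval ![r, s] h₂ := by
  let M := FractionRing (MvPolynomial (Fin n) K)
  have hψ' := map_algebraMap_ne_zero (M := M) hψ
  set f : M := algebraMap (MvPolynomial (Fin n) K) M φ / algebraMap (MvPolynomial (Fin n) K) M ψ
    with hf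
  have hfK : ∀ c, algebraMap K M c ≠ f := by
    intro c hc
    rw [hf, eq_div_iff hψ', IsScalarTower.algebraMap_apply K (MvPolynomial (Fin n) K) M,
      ← map_mul] at hc
    exact hφψ c (IsFractionRing.injective (MvPolynomial (Fin n) K) M hc).symm
  -- The sign makes `φ + λψ` vanish at the generic point.
  obtain ⟨j, hjX, hjK⟩ := exists_ringHom_ratFunc (K := K) (-f) (by
    rintro ⟨c, hc⟩
    exact hfK (-c) (by rw [map_neg, hc, neg_neg]))
  let : Algebra (RatFunc K) M := j.toAlgebra
  have : IsScalarTower K (RatFunc K) M := IsScalarTower.of_algebraMap_eq fun c ↦ (hjK c).symm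
  let E := algebraicClosure (RatFunc K) M
  have : IsScalarTower K E M := IsScalarTower.of_algebraMap_eq fun c ↦ by
    rw [IsScalarTower.algebraMap_apply K (RatFunc K) E,
      ← IsScalarTower.algebraMap_apply (RatFunc K) E M, ← IsScalarTower.algebraMap_apply]
  refine exists_forms_of_not_isMaximalPair_aux (M := M) (E := E) (fun a ha ↦ ?_) hrel hψ hφψ hjX
    hmax i hi
  have : IsAlgebraic (RatFunc K) a := ha.restrictScalars (RatFunc K)
  exact ⟨⟨a, mem_algebraicClosure_iff.2 this⟩, rfl⟩

/-- If the pencil of coprime `φ`, `ψ` is generically reducible, then `φ` and `ψ` are forms of the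
same degree in coprime polynomials of smaller degree. -/
theorem exists_forms_of_not_isMaximalPair {K : Type*} [Field K] [IsAlgClosed K]
    {n : ℕ} {φ ψ : MvPolynomial (Fin n) K} (hrel : IsRelPrime φ ψ)
    (hdeg : 0 < max φ.totalDegree ψ.totalDegree) (hmax : ¬ HomDecomp.IsMaximalPair φ ψ) :
    ∃ (r s : MvPolynomial (Fin n) K) (e : ℕ) (h₁ h₂ : MvPolynomial (Fin 2) K),
      IsRelPrime r s ∧ max r.totalDegree s.totalDegree < max φ.totalDegree ψ.totalDegree ∧
      h₁.IsHomogeneous e ∧ h₂.IsHomogeneous e ∧ φ = aeval ![r, s] h₁ ∧ ψ = aeval ![r, s] h₂ := by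
  have hφψ : ∀ c, φ ≠ C c * ψ := by
    rintro c rfl
    have hψ := totalDegree_eq_zero_of_isUnit (hrel (dvd_mul_left _ _) dvd_rfl)
    have := totalDegree_mul (C c) ψ
    rw [totalDegree_C] at this
    omega
  have hψ : ψ ≠ 0 := by
    rintro rfl
    have := totalDegree_eq_zero_of_isUnit (hrel dvd_rfl (dvd_zero φ))
    rw [totalDegree_zero] at hdeg
    omega
  by_cases h : ∃ i, pderiv i φ ≠ 0 ∨ pderiv i ψ ≠ 0
  · obtain ⟨i, hi⟩ := h
    exact exists_forms_of_not_isMaximalPair_of_pderiv_ne_zero hrel hψ hφψ hmax i hi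
  · push Not at h
    obtain ⟨p, hp⟩ := ExpChar.exists K
    rcases hp with _ | hp
    · exfalso
      have hc : ∀ φ : MvPolynomial (Fin n) K, (∀ i, pderiv i φ = 0) → φ.totalDegree = 0 := by
        intro φ hφ
        rw [totalDegree_eq_zero_iff]
        intro m hm i
        exact_mod_cast natCast_eq_zero_of_pderiv_eq_zero (hφ i) hm
      rw [hc φ fun i ↦ (h i).1, hc ψ fun i ↦ (h i).2] at hdeg
      exact lt_irrefl _ hdeg
    · have : Fact p.Prime := ⟨hp⟩
      obtain ⟨r, rfl⟩ := exists_eq_pow_of_pderiv_eq_zero p fun i ↦ (h i).1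
      obtain ⟨s, rfl⟩ := exists_eq_pow_of_pderiv_eq_zero p fun i ↦ (h i).2
      refine ⟨r, s, p, X 0 ^ p, X 1 ^ p, fun d hr hs ↦ hrel (hr.trans (dvd_pow_self _ hp.ne_zero))
        (hs.trans (dvd_pow_self _ hp.ne_zero)), ?_, isHomogeneous_X_pow _ _,
        isHomogeneous_X_pow _ _, by simp, by simp⟩
      have hr0 : ∀ r : MvPolynomial (Fin n) K, (r ^ p).totalDegree = p * r.totalDegree := fun r ↦
        totalDegree_pow_eq_mul r p
      rw [hr0, hr0] at hdeg ⊢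
      rw [Nat.mul_max_mul_left] at hdeg ⊢
      have h2 := hp.two_le
      have h3 := Nat.pos_of_mul_pos_left hdeg
      nlinarith

/-! ### Descent to a maximal pair -/

theorem proposition2p3 {K : Type*} [Field K] [IsAlgClosed K] {n ℓ : ℕ} (hn : 2 ≤ n)
    (P : MvPolynomial (Fin n) K) (Q : Fin ℓ → MvPolynomial (Fin n) K)
    (hPQ : HomDecomp.Admissible P Q)
    (φ₀ ψ₀ : MvPolynomial (Fin n) K) (d₀ : ℕ)
    (h₀ : HomDecomp.IsHomComposed (HomDecomp.family P Q) φ₀ ψ₀ d₀) :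
    ∃ (φ ψ : MvPolynomial (Fin n) K)
      (H : MvPolynomial (Fin 2) (HomDecomp.ParamClosure K ℓ)) (d : ℕ),
      HomDecomp.IsHomDecomposition (HomDecomp.family P Q) φ ψ H d ∧
      HomDecomp.IsMaximalPair φ ψ ∧
      d₀ ≤ d ∧
      (¬ HomDecomp.IsMaximalPair φ₀ ψ₀ → d₀ < d) := by
  generalize HomDecomp.family P Q = F at h₀ ⊢
  induction hN : max φ₀.totalDegree ψ₀.totalDegree using Nat.strong_induction_on
    generalizing φ₀ ψ₀ d₀ with
  | _ N ih =>
  obtain ⟨H, hH⟩ := h₀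
  by_cases hmax : HomDecomp.IsMaximalPair φ₀ ψ₀
  · exact ⟨φ₀, ψ₀, H, d₀, hH, hmax, le_rfl, fun h ↦ absurd hmax h⟩
  let k := HomDecomp.ParamClosure K ℓ
  have hinj : Function.Injective (algebraMap (MvPolynomial (Fin ℓ) K) k) := by
    rw [IsScalarTower.algebraMap_eq _ (FractionRing (MvPolynomial (Fin ℓ) K)) k]
    exact (algebraMap (FractionRing (MvPolynomial (Fin ℓ) K)) k).injective.comp
      (IsFractionRing.injective _ _)
  have hFdeg : (map (algebraMap (MvPolynomial (Fin ℓ) K) k) F).totalDegree = F.totalDegree := by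
    rw [totalDegree, support_map_of_injective _ hinj, ← totalDegree]
  have hdegK : ∀ φ : MvPolynomial (Fin n) K,
      (map (algebraMap K k) φ).totalDegree = φ.totalDegree := fun φ ↦ by
    rw [totalDegree, support_map_of_injective _ (algebraMap K k).injective, ← totalDegree]
  have hle := totalDegree_aeval_pair_le hH.homogeneous
    (map (algebraMap K k) φ₀) (map (algebraMap K k) ψ₀)
  rw [← hH.eq, hFdeg, hdegK, hdegK] at hle
  have hlt := hH.degree_lt
  have hdeg : 0 < max φ₀.totalDegree ψ₀.totalDegree := by
    by_contra h0
    rw [Nat.eq_zero_of_not_pos h0] at hle hlt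
    omega
  -- Positivity of `d₀` is what makes `e * d₀` strictly larger than `d₀` once `e ≥ 2`.
  have hd₀ : 0 < d₀ := by
    by_contra h0
    rw [Nat.eq_zero_of_not_pos h0] at hle
    omega
  obtain ⟨r, s, e, h₁, h₂, hrs, hlt', hh₁, hh₂, rfl, rfl⟩ :=
    exists_forms_of_not_isMaximalPair hH.relPrime hdeg hmax
  -- Forms of degree at most 1 in `r`, `s` could not have degree above that of the pair `r`, `s`.
  have he : 2 ≤ e := by
    by_contra he
    have h1 := totalDegree_aeval_pair_le hh₁ r s
    have h2 := totalDegree_aeval_pair_le hh₂ r s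
    have h3 : e * max r.totalDegree s.totalDegree ≤ 1 * max r.totalDegree s.totalDegree :=
      Nat.mul_le_mul_right _ (by omega)
    omega
  have hcomp : HomDecomp.IsHomComposed F r s (e * d₀) := by
    refine ⟨aeval ![map (algebraMap K k) h₁, map (algebraMap K k) h₂] H, hrs, hlt'.trans hlt,
      hH.homogeneous.aeval _ fun i ↦ ?_, ?_⟩
    · fin_cases i
      · exact hh₁.map _
      · exact hh₂.map _
    · have hmap : ∀ h : MvPolynomial (Fin 2) K,
          map (algebraMap K k) (aeval ![r, s] h) =
            aeval ![map (algebraMap K k) r, map (algebraMap K k) s] (map (algebraMap K k) h) := by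
        intro h
        rw [aeval_map_algebraMap]
        exact map_aeval_pair (mapAlgHom (Algebra.ofId K k)) h r s
      rw [hH.eq, hmap, hmap]
      exact (map_aeval_pair (aeval (R := k) ![map (algebraMap K k) r, map (algebraMap K k) s]) H
        _ _).symm
  obtain ⟨φ, ψ, H', d, hdec, hmax', hd, -⟩ := ih _ (hN ▸ hlt') r s (e * d₀) hcomp rfl
  have : d₀ < d := by nlinarith
  exact ⟨φ, ψ, H', d, hdec, hmax', this.le, fun _ ↦ this⟩
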